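/- \textbf{Theorem.} A \emph{Boolean function} is a map $f\colon\{0,1\}^n\to\{0,1\}$ with $n\ge 1$. A Boolean function $g$ of arity $m$ is a \emph{simple minor} of a Boolean function $f$ of arity $n$, written $g\le f$, if there is a map $\sigma\colon\{1,\dots,n\}\to\{1,\dots,m\}$ with $g(a_1,\dots,a_m)=f(a_{\sigma(1)},\dots,a_{\sigma(n)})$ for all $a_1,\dots,a_m\in\{0,1\}$. This is a quasi-order on the set $\Omega$ of all Boolean functions; let $f\equiv g$ mean $f\le g$ and $g\le f$, let $\tilde f$ be the class of $f$ under $\equiv$, and let $\tilde\Omega=\Omega/{\equiv}$ be partially ordered by $\tilde g\sqsubseteq\tilde f$ if and only if $g\le f$. A function $f\in\Omega$ is \emph{join-irreducible} if there is $\tilde f'\in\tilde\Omega$ with $\tilde f'\sqsubset\tilde f$ such that every $\tilde g\in\tilde\Omega$ with $\tilde g\sqsubset\tilde f$ satisfies $\tilde g\sqsubseteq\tilde f'$. Let $G=(V,E)$ be a finite undirected graph without loops or multiple edges, with $V$ nonempty. Let $f_G$ be the Boolean function of arity $|V|$, with variables $x_i$ indexed by the vertices $i\in V$ (in some order, which does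 not affect $\tilde f_G$), given by the polynomial $\sum_{\{i,j\}\in E}x_ix_j$ over the two-element field. Call $G$ \emph{join-irreducible} if $f_G$ is join-irreducible. Let $\check G$ be the graph obtained from $G$ by removing all isolated vertices. Write $K_n$ for the complete graph and $\overline{K}_n$ for the edgeless graph on $n$ vertices, $C_5$ for the cycle on $5$ vertices, and $G_1+G_2$ for the graph join (the disjoint union of $G_1$ and $G_2$ together with all edges between a vertex of $G_1$ and a vertex of $G_2$). Then $G$ is join-irreducible if and only if $\check G$ is isomorphic to one of the following graphs: (i) a disjoint union of $n$ copies of $K_3$, for some $n\ge 2$; (ii) $C_5$; (iii) $K_2+\overline{K}_m$, for some $m\ge 2$; (iv) $K_n$, for some $n\ge 2$; (v) $\overline{K}_n+\overline{K}_m$, for some $n,m$ with $1\le n<m$; (vi) a graph join $\overline{K}_n+\dots+\overline{K}_n$ of $r$ copies of $\overline{K}_n$, for some $r,n\ge 2$. -/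

import Mathlib

/-- A Boolean function `{0,1}ⁿ → {0,1}` of some arity `n ≥ 1`; the set `{0,1}` is taken to be the
two-element field `ZMod 2`. The type `BoolFn` is the set of all Boolean functions. -/
structure BoolFn where
  arity : ℕ
  one_le_arity : 1 ≤ arity
  toFun : (Fin arity → ZMod 2) → ZMod 2

/-- `g` is a simple minor of `f`: `g(a₁, …, aₘ) = f(a_{σ(1)}, …, a_{σ(n)})` for some map `σ`. -/
def BoolFn.IsSimpleMinor (g f : BoolFn) : Prop :=
  ∃ σ : Fin f.arity → Fin g.arity,
    ∀ a : Fin g.arity → ZMod 2, g.toFun a = f.toFun (fun i => a (σ i))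

/-- The simple minor quasi-order. -/
instance BoolFn.instPreorder : Preorder BoolFn where
  le g f := BoolFn.IsSimpleMinor g f
  le_refl _ := ⟨id, fun _ => rfl⟩
  le_trans _ _ _ := fun ⟨σ, hσ⟩ ⟨τ, hτ⟩ =>
    ⟨fun i => σ (τ i), fun a => (hσ a).trans (hτ fun i => a (σ i))⟩

/-- The poset of equivalence classes of Boolean functions, where `f` and `g` are equivalent when
each of them is a simple minor of the other. -/
abbrev BoolFnClass : Type := Antisymmetrization BoolFn (· ≤ ·)

/-- An element of a poset is join-irreducible if there is a largest element among
those strictly below it. -/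
def IsJoinIrreducible {P : Type*} [PartialOrder P] (a : P) : Prop :=
  ∃ b : P, b < a ∧ ∀ c : P, c < a → c ≤ b

/-- A Boolean function is join-irreducible if its equivalence class is. -/
def BoolFn.JoinIrreducible (f : BoolFn) : Prop :=
  IsJoinIrreducible (toAntisymmetrization (· ≤ ·) f : BoolFnClass)

/-- A hypergraph on the vertex set `V`: a collection of subsets of `V`. -/
structure Hypergr (V : Type*) where
  edges : Finset (Finset V)

/-- The polynomial `∑_{E} ∏_{i ∈ E} x_i` over the two-element field. -/
noncomputable def Hypergr.poly {V : Type*} (H : Hypergr V) : MvPolynomial V (ZMod 2) :=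
  ∑ E ∈ H.edges, ∏ i ∈ E, MvPolynomial.X i

/-- The Boolean function represented by the polynomial of a hypergraph `H` on a finite nonempty
vertex set `V`. The vertices are numbered by the bijection `Fintype.equivFin V`; another numbering
permutes the variables, and so gives an equivalent function. -/
noncomputable def Hypergr.boolFn {V : Type*} [Fintype V] [Nonempty V] (H : Hypergr V) : BoolFn where
  arity := Fintype.card V
  one_le_arity := Fintype.card_pos
  toFun a := MvPolynomial.eval (fun v => a (Fintype.equivFin V v)) H.poly

namespace SimpleGraph

open Classical in
/-- A loopless graph as a hypergraph: the hyperedges are the sets `{i, j}` with `i` adjacent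
to `j`. -/
noncomputable def toHypergr {V : Type*} [Fintype V] (G : SimpleGraph V) : Hypergr V where
  edges := Finset.univ.filter fun E => ∃ i j : V, G.Adj i j ∧ E = {i, j}

/-- A graph is join-irreducible if the Boolean function that it determines is. -/
def JoinIrreducible {V : Type*} [Fintype V] [Nonempty V] (G : SimpleGraph V) : Prop :=
  G.toHypergr.boolFn.JoinIrreducible

/-- The graph obtained from `G` by removing its isolated vertices. -/
abbrev removeIsolated {V : Type*} (G : SimpleGraph V) : SimpleGraph G.support :=
  G.induce G.support

/-- The edgeless graph on `n` vertices, the complement of `K_n`. -/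
abbrev edgeless (n : ℕ) : SimpleGraph (Fin n) := (completeGraph (Fin n))ᶜ

/-- The graph join: the disjoint union of `G` and `H` together with all the edges between the
vertices of `G` and the vertices of `H`. -/
def graphJoin {V W : Type*} (G : SimpleGraph V) (H : SimpleGraph W) : SimpleGraph (V ⊕ W) :=
  G.sum H ⊔ completeBipartiteGraph V W

/-- The disjoint union of `n` copies of `G`; the copies are indexed by the first coordinate. -/
def disjointCopies {V : Type*} (n : ℕ) (G : SimpleGraph V) : SimpleGraph (Fin n × V) where
  Adj x y := x.1 = y.1 ∧ G.Adj x.2 y.2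
  symm := ⟨fun _ _ h => ⟨h.1.symm, h.2.symm⟩⟩
  loopless := ⟨fun _ h => G.irrefl h.2⟩

/-- The graph join of `r` copies of `G`: vertices in the same copy are adjacent as in `G`, and
vertices in distinct copies are always adjacent. -/
def joinCopies {V : Type*} (r : ℕ) (G : SimpleGraph V) : SimpleGraph (Fin r × V) where
  Adj x y := (x.1 = y.1 ∧ G.Adj x.2 y.2) ∨ x.1 ≠ y.1
  symm := ⟨fun _ _ h => h.imp (fun h => ⟨h.1.symm, h.2.symm⟩) Ne.symm⟩
  loopless := ⟨fun _ h => h.elim (fun h => G.irrefl h.2) fun h => h rfl⟩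

end SimpleGraph

/-! A strict minor of a function `f` must identify two essential variables, so `f` is
join-irreducible exactly when one of its two-variable identifications lies above all the others
(`BoolFn.joinIrreducible_ofFn_iff`). Isolated vertices are inessential variables and may be dropped.

Identifying `k` and `l` in a graph on `n` non-isolated vertices leaves `n - 1` essential variables
unless `{k, l}` is the neighbourhood of a vertex, which then cancels, or `k` and `l` are nonadjacent
twins, so that the merged variable cancels. The minors of the remaining, nondegenerate, pairs have
the largest possible number of essential variables, so in a join-irreducible graph they are all
equivalent. Such a minor has the linear term `x_k` (from `x_k²`) exactly when `k` and `l` are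
adjacent, and then the number of vertices distinguishing them is an invariant
(`IsNondegeneratePair.adj_and_ncard_le`).

If every edge is the neighbourhood of some vertex, the components are triangles. If not, every
nonadjacent pair is a neighbourhood or a pair of twins. A nonadjacent pair that is not twins forces
`C₅`; otherwise the graph is complete multipartite, and equality of the invariant over nondegenerate
edges restricts the part sizes. Conversely, in each listed graph symmetry makes one type of pair
uniform, and any other pair is degenerate and lies below a pair of that type. -/

/-! ### Minors, essential variables and identification of two variables. -/

/-- `g` arises from `f` by substituting variables for variables; arities are arbitrary types. -/
def FnMinor {α β : Type*} (g : (β → ZMod 2) → ZMod 2) (f : (α → ZMod 2) → ZMod 2) : Prop :=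
  ∃ σ : α → β, ∀ a, g a = f (fun i => a (σ i))

/-- The set of essential variables of a function. -/
def essVars {α : Type*} (f : (α → ZMod 2) → ZMod 2) : Set α :=
  {i | ∃ a b : α → ZMod 2, (∀ j, j ≠ i → a j = b j) ∧ f a ≠ f b}

open Classical in
/-- The function obtained from `f` by substituting the variable `k` for the variable `l`. -/
noncomputable def mergeVars {α : Type*} (f : (α → ZMod 2) → ZMod 2) (k l : α) :
    (α → ZMod 2) → ZMod 2 :=
  fun a => f (fun x => if x = l then a k else a x)

section Functions

variable {α β γ : Type*}

theorem FnMinor.refl (f : (α → ZMod 2) → ZMod 2) : FnMinor f f := ⟨id, fun _ => rfl⟩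

theorem FnMinor.trans {h : (γ → ZMod 2) → ZMod 2} {g : (β → ZMod 2) → ZMod 2}
    {f : (α → ZMod 2) → ZMod 2} (hg : FnMinor h g) (gf : FnMinor g f) : FnMinor h f := by
  obtain ⟨σ, hσ⟩ := hg
  obtain ⟨τ, hτ⟩ := gf
  exact ⟨fun i => σ (τ i), fun a => (hσ a).trans (hτ _)⟩

/-- Pass from `a` to `b` one coordinate at a time: each step either changes nothing or changes an
inessential coordinate. -/
theorem apply_eq_of_eqOn_essVars [Finite α] {f : (α → ZMod 2) → ZMod 2} {a b : α → ZMod 2}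
    (h : ∀ i ∈ essVars f, a i = b i) : f a = f b := by
  classical
  have := Fintype.ofFinite α
  have key : ∀ s : Finset α, f (s.piecewise b a) = f a := by
    intro s
    induction s using Finset.induction_on with
    | empty => simp
    | insert i s _ ih =>
      rw [← ih]
      by_cases hi : i ∈ essVars f
      · congr 1
        rw [Finset.piecewise_insert]
        ext j
        by_cases hj : j = i
        · subst hj
          by_cases hs : j ∈ s <;> simp [hs, h j hi]
        · simp [hj]
      · by_contra hne
        refine hi ⟨_, _, fun j hj => ?_, hne⟩
        rw [Finset.piecewise_insert]
        simp [hj]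
  simpa using (key Finset.univ).symm

theorem essVars_subset_image [Finite α] {g : (β → ZMod 2) → ZMod 2} {f : (α → ZMod 2) → ZMod 2}
    {σ : α → β} (h : ∀ a, g a = f (fun i => a (σ i))) : essVars g ⊆ σ '' essVars f := by
  rintro y ⟨a, b, hab, hne⟩
  by_contra hy
  refine hne ?_
  rw [h, h]
  exact apply_eq_of_eqOn_essVars fun i hi => hab _ fun e => hy ⟨i, hi, e⟩

theorem FnMinor.ncard_essVars_le [Finite α] {g : (β → ZMod 2) → ZMod 2}
    {f : (α → ZMod 2) → ZMod 2} (h : FnMinor g f) :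
    (essVars g).ncard ≤ (essVars f).ncard := by
  obtain ⟨σ, hσ⟩ := h
  exact (Set.ncard_le_ncard (essVars_subset_image hσ) (Set.toFinite _)).trans
    (Set.ncard_image_le (Set.toFinite _))

/-- The image of `essVars f` covers `essVars g`, so by counting no two essential variables are
identified. -/
theorem injOn_essVars [Finite α] {g : (β → ZMod 2) → ZMod 2} {f : (α → ZMod 2) → ZMod 2}
    {σ : α → β} (h : ∀ a, g a = f (fun i => a (σ i)))
    (hc : (essVars f).ncard ≤ (essVars g).ncard) : Set.InjOn σ (essVars f) := by
  refine Set.injOn_of_ncard_image_eq (le_antisymm (Set.ncard_image_le (Set.toFinite _)) ?_)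
  exact hc.trans (Set.ncard_le_ncard (essVars_subset_image h) (Set.toFinite _))

/-- An inverse of `σ` on the essential variables undoes the substitution; its values elsewhere do
not matter. -/
theorem fnMinor_of_injOn [Finite α] [Nonempty α] {g : (β → ZMod 2) → ZMod 2}
    {f : (α → ZMod 2) → ZMod 2} {σ : α → β} (h : ∀ a, g a = f (fun i => a (σ i)))
    (hi : Set.InjOn σ (essVars f)) : FnMinor f g := by
  refine ⟨Function.invFunOn σ (essVars f), fun a => ?_⟩
  rw [h]
  refine apply_eq_of_eqOn_essVars fun i hi' => ?_
  rw [hi.leftInvOn_invFunOn hi']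

theorem not_mem_essVars_mergeVars (f : (α → ZMod 2) → ZMod 2) {k l : α} (h : k ≠ l) :
    l ∉ essVars (mergeVars f k l) := by
  rintro ⟨a, b, hab, hne⟩
  refine hne ?_
  unfold mergeVars
  congr 1
  ext x
  split_ifs with hx
  · exact hab _ h
  · exact hab _ hx

theorem fnMinor_mergeVars (f : (α → ZMod 2) → ZMod 2) (k l : α) : FnMinor (mergeVars f k l) f := by
  classical
  refine ⟨fun x => if x = l then k else x, fun a => ?_⟩
  unfold mergeVars
  congr 1
  ext x
  simp only
  split_ifs <;> rfl

theorem essVars_mergeVars_subset [Finite α] (f : (α → ZMod 2) → ZMod 2) {k l : α} (h : k ≠ l)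
    (hk : k ∈ essVars f) : essVars (mergeVars f k l) ⊆ essVars f \ {l} := by
  intro x hx
  refine ⟨?_, fun e => not_mem_essVars_mergeVars f h (e ▸ hx)⟩
  by_contra hxf
  obtain ⟨a, b, hab, hne⟩ := hx
  refine hne (apply_eq_of_eqOn_essVars (f := f) fun i hi => ?_)
  split_ifs with hl
  · exact hab _ fun e => hxf (e ▸ hk)
  · exact hab _ fun e => hxf (e ▸ hi)

/-- The variable `l` is lost and, since `k` was already essential, none is gained; minors cannot
increase the number of essential variables. -/
theorem not_fnMinor_mergeVars [Finite α] (f : (α → ZMod 2) → ZMod 2) {k l : α} (h : k ≠ l)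
    (hk : k ∈ essVars f) (hl : l ∈ essVars f) : ¬ FnMinor f (mergeVars f k l) := by
  intro hm
  have h1 := hm.ncard_essVars_le
  have h2 := Set.ncard_le_ncard (essVars_mergeVars_subset f h hk) (Set.toFinite _)
  have h3 := Set.ncard_sdiff_singleton_lt_of_mem hl (Set.toFinite _)
  omega

theorem fnMinor_mergeVars_of_apply_eq {g : (β → ZMod 2) → ZMod 2} {f : (α → ZMod 2) → ZMod 2}
    {σ : α → β} (h : ∀ a, g a = f (fun i => a (σ i))) {k l : α} (hkl : σ k = σ l) :
    FnMinor g (mergeVars f k l) := by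
  refine ⟨σ, fun a => ?_⟩
  rw [h]
  unfold mergeVars
  congr 1
  ext x
  split_ifs with hx
  · simp only [hx, hkl]
  · rfl

/-- Once `k` and `l` are identified, `w` no longer matters and may be replaced by the image of any
`u`; the composite substitution then identifies `w` with `u`. This places a degenerate
identification below others. -/
theorem mergeVars_fnMinor_of_not_mem [Finite α] {f : (α → ZMod 2) → ZMod 2} {k l w u : α}
    (hw : w ∉ essVars (mergeVars f k l)) (hwl : w ≠ l) :
    FnMinor (mergeVars f k l) (mergeVars f w u) := by
  classical
  let p : α → α := fun x => if x = l then k else x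
  let r : α → α := fun x => if x = w then p u else x
  have hr : ∀ a, mergeVars f k l a = mergeVars f k l (fun x => a (r x)) := fun a =>
    apply_eq_of_eqOn_essVars fun i hi => by
      have : i ≠ w := fun e => hw (e ▸ hi)
      simp [r, this]
  refine fnMinor_mergeVars_of_apply_eq (σ := fun x => r (p x)) (fun a => ?_) ?_
  · rw [hr]
    unfold mergeVars
    congr 1
    ext x
    simp only [p]
    split_ifs <;> rfl
  · have h1 : p w = w := if_neg hwl
    have h2 : r w = p u := if_pos rfl
    have h3 : r (p u) = p u := by
      simp only [r]
      split_ifs <;> rfl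
    rw [h1, h2, h3]

theorem mergeVars_fnMinor_of_perm {f : (α → ZMod 2) → ZMod 2} (φ : α → α)
    (hφ : ∀ a, f a = f (fun x => a (φ x))) {i j k l : α} (hi : φ i = k) (hj : φ j = l) :
    FnMinor (mergeVars f k l) (mergeVars f i j) := by
  classical
  refine fnMinor_mergeVars_of_apply_eq (σ := fun x => if φ x = l then k else φ x)
    (fun a => ?_) ?_
  · unfold mergeVars
    rw [hφ]
    congr 1
    ext x
    split_ifs <;> rfl
  · simp [hi, hj]

end Functions

/-! ### Join-irreducibility in terms of identifications. -/

/-- The Boolean function given by a function with variables indexed by a finite type. -/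
noncomputable def BoolFn.ofFn {V : Type*} [Fintype V] [Nonempty V]
    (f : (V → ZMod 2) → ZMod 2) : BoolFn where
  arity := Fintype.card V
  one_le_arity := Fintype.card_pos
  toFun a := f (fun v => a (Fintype.equivFin V v))

theorem BoolFn.le_ofFn_iff {V : Type*} [Fintype V] [Nonempty V] {f : (V → ZMod 2) → ZMod 2}
    {g : BoolFn} : g ≤ BoolFn.ofFn f ↔ FnMinor g.toFun f := by
  constructor
  · rintro ⟨σ, hσ⟩
    exact ⟨fun v => σ (Fintype.equivFin V v), hσ⟩
  · rintro ⟨σ, hσ⟩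
    refine ⟨fun i => σ ((Fintype.equivFin V).symm i), fun a => ?_⟩
    rw [hσ]
    simp [BoolFn.ofFn]

theorem BoolFn.ofFn_le_iff {V : Type*} [Fintype V] [Nonempty V] {f : (V → ZMod 2) → ZMod 2}
    {g : BoolFn} : BoolFn.ofFn f ≤ g ↔ FnMinor f g.toFun := by
  constructor
  · rintro ⟨σ, hσ⟩
    refine ⟨fun i => (Fintype.equivFin V).symm (σ i), fun a => ?_⟩
    have := hσ (fun i => a ((Fintype.equivFin V).symm i))
    simpa [BoolFn.ofFn] using this
  · rintro ⟨σ, hσ⟩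
    exact ⟨fun i => Fintype.equivFin V (σ i), fun a => hσ _⟩

theorem BoolFn.ofFn_le_ofFn_iff {V W : Type*} [Fintype V] [Nonempty V] [Fintype W] [Nonempty W]
    {f : (V → ZMod 2) → ZMod 2} {g : (W → ZMod 2) → ZMod 2} :
    BoolFn.ofFn g ≤ BoolFn.ofFn f ↔ FnMinor g f := by
  constructor
  · intro h
    exact (BoolFn.ofFn_le_iff.1 le_rfl).trans (BoolFn.le_ofFn_iff.1 h)
  · intro h
    exact BoolFn.le_ofFn_iff.2 ((BoolFn.le_ofFn_iff.1 le_rfl).trans h)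

theorem BoolFn.joinIrreducible_iff {f : BoolFn} :
    f.JoinIrreducible ↔ ∃ b : BoolFn, b < f ∧ ∀ c : BoolFn, c < f → c ≤ b := by
  constructor
  · rintro ⟨b, hb, hc⟩
    induction b using Antisymmetrization.ind with
    | _ b => exact ⟨b, hb, fun c h => hc (toAntisymmetrization _ c) h⟩
  · rintro ⟨b, hb, hc⟩
    refine ⟨toAntisymmetrization _ b, hb, fun c h => ?_⟩
    induction c using Antisymmetrization.ind with
    | _ c => exact hc c h

theorem BoolFn.JoinIrreducible.of_equiv {f g : BoolFn} (h1 : f ≤ g) (h2 : g ≤ f)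
    (h : f.JoinIrreducible) : g.JoinIrreducible := by
  rw [BoolFn.joinIrreducible_iff] at h ⊢
  obtain ⟨b, hb, hc⟩ := h
  exact ⟨b, hb.trans_le h1, fun c h => hc c (h.trans_le h2)⟩

/-- A substitution injective on the essential variables gives an equivalent function. So every
strict minor lies below an identification of two essential variables, which is itself strict. -/
theorem BoolFn.joinIrreducible_ofFn_iff {V : Type*} [Fintype V] [Nonempty V]
    {f : (V → ZMod 2) → ZMod 2} :
    (BoolFn.ofFn f).JoinIrreducible ↔ ∃ i ∈ essVars f, ∃ j ∈ essVars f, i ≠ j ∧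
      ∀ k ∈ essVars f, ∀ l ∈ essVars f, k ≠ l →
        FnMinor (mergeVars f k l) (mergeVars f i j) := by
  have lt_merge : ∀ {k l : V}, k ∈ essVars f → l ∈ essVars f → k ≠ l →
      BoolFn.ofFn (mergeVars f k l) < BoolFn.ofFn f := fun hk hl h =>
    lt_of_le_not_ge (BoolFn.ofFn_le_ofFn_iff.2 (fnMinor_mergeVars f _ _))
      fun h' => not_fnMinor_mergeVars f h hk hl (BoolFn.ofFn_le_ofFn_iff.1 h')
  have le_merge : ∀ b : BoolFn, b < BoolFn.ofFn f → ∃ i ∈ essVars f, ∃ j ∈ essVars f, i ≠ j ∧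
      b ≤ BoolFn.ofFn (mergeVars f i j) := by
    intro b hb
    obtain ⟨σ, hσ⟩ := BoolFn.le_ofFn_iff.1 hb.le
    have hn : ¬ Set.InjOn σ (essVars f) := fun hi =>
      hb.not_ge (BoolFn.ofFn_le_iff.2 (fnMinor_of_injOn hσ hi))
    simp only [Set.InjOn, not_forall] at hn
    obtain ⟨i, hi, j, hj, hij, hne⟩ := hn
    exact ⟨i, hi, j, hj, hne, BoolFn.le_ofFn_iff.2 (fnMinor_mergeVars_of_apply_eq hσ hij)⟩
  rw [BoolFn.joinIrreducible_iff]
  constructor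
  · rintro ⟨b, hb, hc⟩
    obtain ⟨i, hi, j, hj, hij, hle⟩ := le_merge b hb
    refine ⟨i, hi, j, hj, hij, fun k hk l hl hkl => ?_⟩
    exact BoolFn.ofFn_le_ofFn_iff.1 ((hc _ (lt_merge hk hl hkl)).trans hle)
  · rintro ⟨i, hi, j, hj, hij, h⟩
    refine ⟨_, lt_merge hi hj hij, fun c hc => ?_⟩
    obtain ⟨k, hk, l, hl, hkl, hle⟩ := le_merge c hc
    exact hle.trans (BoolFn.ofFn_le_ofFn_iff.2 (h k hk l hl hkl))

/-! ### The quadratic function of a graph and its identifications. -/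

namespace SimpleGraph

section AdjVal

variable {V : Type*}

open Classical in
/-- The adjacency of two vertices as an element of the two-element field. -/
noncomputable def adjVal (G : SimpleGraph V) (i j : V) : ZMod 2 := if G.Adj i j then 1 else 0

theorem adjVal_of_adj {G : SimpleGraph V} {i j : V} (h : G.Adj i j) : G.adjVal i j = 1 := if_pos h

theorem adjVal_of_not_adj {G : SimpleGraph V} {i j : V} (h : ¬ G.Adj i j) : G.adjVal i j = 0 :=
  if_neg h

theorem adjVal_comm (G : SimpleGraph V) (i j : V) : G.adjVal i j = G.adjVal j i := by
  by_cases h : G.Adj i j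
  · rw [adjVal_of_adj h, adjVal_of_adj h.symm]
  · rw [adjVal_of_not_adj h, adjVal_of_not_adj fun h' => h h'.symm]

end AdjVal

variable {V W : Type*} [Fintype V] [Fintype W]

/-- The function `∑_{ {i, j} ∈ E } a i * a j` of a graph, with variables indexed by vertices. -/
noncomputable def edgeFn (G : SimpleGraph V) (a : V → ZMod 2) : ZMod 2 :=
  MvPolynomial.eval a G.toHypergr.poly

theorem edgeFn_eq_sum (G : SimpleGraph V) (a : V → ZMod 2) :
    G.edgeFn a = ∑ E ∈ G.toHypergr.edges, ∏ i ∈ E, a i := by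
  simp [edgeFn, Hypergr.poly]

theorem mem_edges_toHypergr {G : SimpleGraph V} {E : Finset V} [DecidableEq V] :
    E ∈ G.toHypergr.edges ↔ ∃ i j : V, G.Adj i j ∧ E = {i, j} := by
  simp only [toHypergr, Finset.mem_filter, Finset.mem_univ, true_and]
  convert Iff.rfl

open Classical in
-- Only edges through `m` change, and without loops the dependence on `a m` is affine, with slope
-- the sum over the neighbours.
theorem edgeFn_add_single (G : SimpleGraph V) (a : V → ZMod 2) (m : V) (c : ZMod 2) :
    G.edgeFn (a + Pi.single m c) = G.edgeFn a + c * ∑ j, G.adjVal m j * a j := by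
  simp only [edgeFn_eq_sum]
  rw [← Finset.sum_filter_add_sum_filter_not _ (fun E => m ∈ E),
    ← Finset.sum_filter_add_sum_filter_not (s := G.toHypergr.edges)
      (f := fun E => ∏ i ∈ E, a i) (fun E => m ∈ E)]
  have h0 : ∀ E ∈ G.toHypergr.edges.filter (fun E => ¬ m ∈ E),
      ∏ i ∈ E, (a + Pi.single m c : V → ZMod 2) i = ∏ i ∈ E, a i := by
    intro E hE
    refine Finset.prod_congr rfl fun i hi => ?_
    have : i ≠ m := fun e => (Finset.mem_filter.1 hE).2 (e ▸ hi)
    simp [this]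
  rw [Finset.sum_congr rfl h0]
  have h1 : ∀ b : V → ZMod 2, ∑ E ∈ G.toHypergr.edges.filter (fun E => m ∈ E), ∏ i ∈ E, b i =
      ∑ j with G.Adj m j, b m * b j := by
    intro b
    symm
    refine Finset.sum_bij (fun j _ => {m, j}) ?_ ?_ ?_ ?_
    · intro j hj
      simp only [Finset.mem_filter, Finset.mem_univ, true_and] at hj
      simp only [Finset.mem_filter, mem_edges_toHypergr]
      exact ⟨⟨m, j, hj, rfl⟩, by simp⟩
    · intro j hj j' hj' h
      simp only [Finset.mem_filter, Finset.mem_univ, true_and] at hj hj'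
      have : j ∈ ({m, j'} : Finset V) := by rw [← h]; simp
      simpa [hj.ne'] using this
    · intro E hE
      simp only [Finset.mem_filter, mem_edges_toHypergr] at hE
      obtain ⟨⟨i, j, hij, rfl⟩, hm⟩ := hE
      rcases Finset.mem_insert.1 hm with rfl | hm
      · exact ⟨j, by simpa using hij, rfl⟩
      · rw [Finset.mem_singleton] at hm
        subst hm
        exact ⟨i, by simpa using hij.symm, Finset.pair_comm _ _⟩
    · intro j hj
      simp only [Finset.mem_filter, Finset.mem_univ, true_and] at hj
      rw [Finset.prod_pair hj.ne]
  rw [h1, h1, add_right_comm]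
  congr 1
  rw [Finset.mul_sum, Finset.sum_filter, Finset.sum_filter, ← Finset.sum_add_distrib]
  refine Finset.sum_congr rfl fun j _ => ?_
  by_cases h : G.Adj m j
  · simp only [h, if_true, adjVal_of_adj, Pi.add_apply, Pi.single_eq_same, one_mul,
      Pi.single_eq_of_ne h.ne', add_zero]
    ring
  · simp [h, adjVal_of_not_adj]

theorem edgeFn_zero (G : SimpleGraph V) : G.edgeFn 0 = 0 := by
  classical
  rw [edgeFn_eq_sum]
  refine Finset.sum_eq_zero fun E hE => ?_
  obtain ⟨i, j, -, rfl⟩ := mem_edges_toHypergr.1 hE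
  exact Finset.prod_eq_zero (Finset.mem_insert_self i _) rfl

open Classical in
theorem edgeFn_single (G : SimpleGraph V) (m : V) (c : ZMod 2) : G.edgeFn (Pi.single m c) = 0 := by
  have := G.edgeFn_add_single 0 m c
  simpa [edgeFn_zero] using this

open Classical in
theorem edgeFn_add_single_one (G : SimpleGraph V) (a : V → ZMod 2) {j : V} :
    G.edgeFn (a + Pi.single j 1) = G.edgeFn a + ∑ i, G.adjVal j i * a i := by
  rw [edgeFn_add_single, one_mul]

open Classical in
theorem edgeFn_single_add_single (G : SimpleGraph V) (i j : V) :
    G.edgeFn (Pi.single i 1 + Pi.single j 1) = G.adjVal j i := by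
  rw [edgeFn_add_single_one, edgeFn_single]
  simp [Pi.single_apply]

theorem edgeFn_comp_iso {G : SimpleGraph V} {H : SimpleGraph W} (φ : H ≃g G) (a : V → ZMod 2) :
    G.edgeFn a = H.edgeFn fun x => a (φ x) := by
  classical
  rw [edgeFn_eq_sum, edgeFn_eq_sum]
  symm
  refine Finset.sum_bij (fun E _ => E.map φ.toEquiv.toEmbedding) ?_ ?_ ?_ ?_
  · intro E hE
    obtain ⟨i, j, hij, rfl⟩ := mem_edges_toHypergr.1 hE
    refine mem_edges_toHypergr.2 ⟨φ i, φ j, φ.map_adj_iff.2 hij, ?_⟩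
    simp [Finset.map_insert]
  · intro E _ E' _ h
    exact Finset.map_injective _ h
  · intro E hE
    obtain ⟨i, j, hij, rfl⟩ := mem_edges_toHypergr.1 hE
    refine ⟨{φ.symm i, φ.symm j}, mem_edges_toHypergr.2 ⟨_, _, φ.symm.map_adj_iff.2 hij, rfl⟩, ?_⟩
    simp [Finset.map_insert]
  · intro E _
    simp

theorem essVars_edgeFn (G : SimpleGraph V) : essVars G.edgeFn = G.support := by
  classical
  ext m
  constructor
  · rintro ⟨a, b, hab, hne⟩
    by_contra hm
    have hm' : ∀ j, ¬ G.Adj m j := fun j hj => hm ⟨j, hj⟩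
    refine hne ?_
    have : b = a + Pi.single m (b m - a m) := by
      ext j
      by_cases hj : j = m
      · subst hj; simp
      · simp [hj, hab j hj]
    rw [this, edgeFn_add_single]
    simp [adjVal_of_not_adj (hm' _)]
  · rintro ⟨j, hj⟩
    -- With only the neighbour `j` switched on, switching `m` on completes exactly one edge.
    refine ⟨Pi.single j 1, Pi.single j 1 + Pi.single m 1, fun i hi => by simp [hi], ?_⟩
    rw [edgeFn_single_add_single, edgeFn_single, adjVal_of_adj hj]
    decide

open Classical in
theorem joinIrreducible_iff_mergeVars [Nonempty V] (G : SimpleGraph V) :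
    G.JoinIrreducible ↔ ∃ i ∈ G.support, ∃ j ∈ G.support, i ≠ j ∧
      ∀ k ∈ G.support, ∀ l ∈ G.support, k ≠ l →
        FnMinor (mergeVars G.edgeFn k l) (mergeVars G.edgeFn i j) := by
  rw [← essVars_edgeFn]
  exact BoolFn.joinIrreducible_ofFn_iff (f := G.edgeFn)

open Classical in
theorem edgeFn_eq_removeIsolated (G : SimpleGraph V) (a : V → ZMod 2) :
    G.edgeFn a = G.removeIsolated.edgeFn fun x => a x := by
  rw [edgeFn_eq_sum, edgeFn_eq_sum]
  symm
  refine Finset.sum_bij (fun E _ => E.map (Function.Embedding.subtype _)) ?_ ?_ ?_ ?_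
  · intro E hE
    obtain ⟨i, j, hij, rfl⟩ := mem_edges_toHypergr.1 hE
    exact mem_edges_toHypergr.2 ⟨i, j, hij, by simp [Finset.map_insert]⟩
  · intro E _ E' _ h
    exact Finset.map_injective _ h
  · intro E hE
    obtain ⟨i, j, hij, rfl⟩ := mem_edges_toHypergr.1 hE
    refine ⟨{⟨i, j, hij⟩, ⟨j, i, hij.symm⟩}, mem_edges_toHypergr.2 ⟨_, _, ?_, rfl⟩, ?_⟩
    · exact hij
    · simp [Finset.map_insert]
  · intro E _
    simp

open Classical in
theorem joinIrreducible_iff_of_iso [Nonempty V] [Nonempty W] {G : SimpleGraph V}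
    {H : SimpleGraph W} (φ : G.removeIsolated ≃g H) : G.JoinIrreducible ↔ H.JoinIrreducible := by
  have h1 : ∀ a, G.edgeFn a = H.edgeFn (fun x => a (φ.symm x)) := fun a => by
    rw [edgeFn_eq_removeIsolated, edgeFn_comp_iso φ.symm]
  have hi : Function.Injective (fun x : W => ((φ.symm x : G.support) : V)) :=
    Subtype.val_injective.comp φ.symm.injective
  have h2 : FnMinor H.edgeFn G.edgeFn := fnMinor_of_injOn h1 hi.injOn
  have h3 := BoolFn.ofFn_le_ofFn_iff.2 h2
  have h4 := BoolFn.ofFn_le_ofFn_iff.2 (⟨_, h1⟩ : FnMinor G.edgeFn H.edgeFn)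
  exact ⟨BoolFn.JoinIrreducible.of_equiv h4 h3, BoolFn.JoinIrreducible.of_equiv h3 h4⟩

open Classical in
theorem mergeVars_edgeFn_add_single_of_ne (G : SimpleGraph V) {k l m : V} (hk : m ≠ k)
    (hl : m ≠ l) (a : V → ZMod 2) (c : ZMod 2) :
    mergeVars G.edgeFn k l (a + Pi.single m c) = mergeVars G.edgeFn k l a +
      c * ∑ j, G.adjVal m j * (if j = l then a k else a j) := by
  unfold mergeVars
  rw [← edgeFn_add_single]
  congr 1
  ext x
  by_cases hx : x = l
  · subst hx
    simp [hk.symm, hl.symm]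
  · simp [hx]

open Classical in
-- Both `k` and `l` are shifted by `c`; the edge between them, if present, contributes the extra `c
-- * c`.
theorem mergeVars_edgeFn_add_single_self (G : SimpleGraph V) {k l : V} (h : k ≠ l)
    (a : V → ZMod 2) (c : ZMod 2) :
    mergeVars G.edgeFn k l (a + Pi.single k c) = mergeVars G.edgeFn k l a +
      c * (c * G.adjVal k l +
        ∑ j, (G.adjVal k j + G.adjVal l j) * (if j = l then a k else a j)) := by
  unfold mergeVars
  have : (fun x => if x = l then (a + Pi.single k c : V → ZMod 2) k else (a + Pi.single k c : V → ZMod 2) x) =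
      (fun x => if x = l then a k else a x) + Pi.single k c + Pi.single l c := by
    ext x
    by_cases hx : x = l
    · subst hx
      simp [h.symm]
    · simp [hx]
  rw [this, edgeFn_add_single, edgeFn_add_single]
  simp only [Pi.add_apply, mul_add, add_mul, Finset.sum_add_distrib, Pi.single_apply]
  simp [adjVal_comm G l k]
  ring

end SimpleGraph

/-! ### Nondegenerate pairs and the invariants of their minors. -/

namespace SimpleGraph

/-- Two distinct vertices that are neither nonadjacent twins nor the neighbourhood of a vertex. -/
structure IsNondegeneratePair {V : Type*} (G : SimpleGraph V) (k l : V) : Prop where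
  ne : k ≠ l
  not_nbhd : ∀ w, ¬ ∀ x, G.Adj w x ↔ x = k ∨ x = l
  not_twins : G.Adj k l ∨ ∃ x, ¬ (G.Adj k x ↔ G.Adj l x)

/-- The vertices other than `k` and `l` that are adjacent to exactly one of them. -/
def distinguishing {V : Type*} (G : SimpleGraph V) (k l : V) : Set V :=
  {y | y ≠ k ∧ y ≠ l ∧ ¬ (G.Adj k y ↔ G.Adj l y)}

open Classical in
theorem eq_add_single_of_forall_ne {V : Type*} {m : V} {a b : V → ZMod 2} (h : ∀ j, j ≠ m → a j = b j) :
    b = a + Pi.single m (b m - a m) := by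
  ext j
  by_cases hj : j = m
  · subst hj; simp
  · simp [hj, h j hj]

theorem adjVal_add_eq_one_iff {V : Type*} {G : SimpleGraph V} {k l x : V} :
    G.adjVal k x + G.adjVal l x = 1 ↔ ¬ (G.Adj k x ↔ G.Adj l x) := by
  by_cases h1 : G.Adj k x <;> by_cases h2 : G.Adj l x <;>
    simp [adjVal_of_adj, adjVal_of_not_adj, h1, h2]

section MergeVars

variable {V : Type*} [Fintype V] {G : SimpleGraph V} {k l : V}

/-- The two terms containing `w` become equal and cancel in characteristic two. -/
theorem not_mem_essVars_of_nbhd (h : k ≠ l) {w : V} (hw : ∀ x, G.Adj w x ↔ x = k ∨ x = l) :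
    w ∉ essVars (mergeVars G.edgeFn k l) := by
  classical
  rintro ⟨a, b, hab, hne⟩
  refine hne ?_
  have hA : ∀ j, G.adjVal w j = (if j = k then 1 else 0) + (if j = l then 1 else 0) := by
    intro j
    by_cases hk : j = k
    · rw [adjVal_of_adj ((hw j).2 (.inl hk)), if_pos hk, if_neg (fun e => h (hk ▸ e)), add_zero]
    · by_cases hl : j = l
      · rw [adjVal_of_adj ((hw j).2 (.inr hl)), if_pos hl, if_neg hk, zero_add]
      · rw [adjVal_of_not_adj fun e => ((hw j).1 e).elim hk hl, if_neg hk, if_neg hl, zero_add]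
  rw [eq_add_single_of_forall_ne hab,
    mergeVars_edgeFn_add_single_of_ne _ ((hw k).2 (.inl rfl)).ne ((hw l).2 (.inr rfl)).ne]
  have hs : ∀ j, G.adjVal w j * (if j = l then a k else a j) =
      (if j = k then a k else 0) + (if j = l then a k else 0) := by
    intro j
    rw [hA]
    by_cases hk : j = k
    · subst hk; simp [h]
    · by_cases hl : j = l
      · subst hl; simp [hk]
      · simp [hk, hl]
  rw [Finset.sum_congr rfl fun j _ => hs j, Finset.sum_add_distrib]
  simp [CharTwo.add_self_eq_zero]

/-- Every common neighbour contributes its term twice, and there is no edge to leave a linear term.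
-/
theorem not_mem_essVars_of_twins (h : k ≠ l) (hkl : ¬ G.Adj k l)
    (ht : ∀ x, G.Adj k x ↔ G.Adj l x) : k ∉ essVars (mergeVars G.edgeFn k l) := by
  classical
  rintro ⟨a, b, hab, hne⟩
  refine hne ?_
  have hA : ∀ j, G.adjVal k j + G.adjVal l j = 0 := by
    intro j
    by_cases hj : G.Adj k j
    · rw [adjVal_of_adj hj, adjVal_of_adj ((ht j).1 hj)]
      decide
    · rw [adjVal_of_not_adj hj, adjVal_of_not_adj (fun e => hj ((ht j).2 e)), add_zero]
  rw [eq_add_single_of_forall_ne hab, mergeVars_edgeFn_add_single_self _ h]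
  simp [hA, adjVal_of_not_adj hkl]

theorem mergeVars_edgeFn_zero (G : SimpleGraph V) (k l : V) : mergeVars G.edgeFn k l 0 = 0 :=
  (congrArg G.edgeFn (by ext; simp)).trans G.edgeFn_zero

open Classical in
theorem mergeVars_edgeFn_single_self (h : k ≠ l) :
    mergeVars G.edgeFn k l (Pi.single k 1) = G.adjVal k l := by
  have h0 := mergeVars_edgeFn_zero G k l
  have := mergeVars_edgeFn_add_single_self G h 0 1
  simpa [h0] using this

open Classical in
theorem mergeVars_edgeFn_single_of_ne (h : k ≠ l) {x : V} (hx : x ≠ k) :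
    mergeVars G.edgeFn k l (Pi.single x 1) = 0 := by
  have h0 := mergeVars_edgeFn_zero G k l
  by_cases hl : x = l
  · subst hl
    rw [← h0]
    unfold mergeVars
    congr 1
    ext y
    by_cases hy : y = x <;> simp [hy, h]
  · have := mergeVars_edgeFn_add_single_of_ne G hx hl 0 1
    simpa [h0] using this

open Classical in
theorem mergeVars_edgeFn_single_add_single (h : k ≠ l) {y : V} (hk : y ≠ k) (hl : y ≠ l) :
    mergeVars G.edgeFn k l (Pi.single k 1 + Pi.single y 1) =
      G.adjVal k l + (G.adjVal k y + G.adjVal l y) := by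
  rw [mergeVars_edgeFn_add_single_of_ne _ hk hl, mergeVars_edgeFn_single_self h, one_mul]
  congr 1
  have : ∀ j, G.adjVal y j * (if j = l then (Pi.single k 1 : V → ZMod 2) k
      else (Pi.single k 1 : V → ZMod 2) j) =
      (if j = k then G.adjVal y k else 0) + (if j = l then G.adjVal y l else 0) := by
    intro j
    by_cases hjk : j = k
    · subst hjk; simp [h]
    · by_cases hjl : j = l
      · subst hjl; simp [hjk]
      · simp [hjk, hjl]
  rw [Finset.sum_congr rfl fun j _ => this j, Finset.sum_add_distrib]
  simp [adjVal_comm G y]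

theorem IsNondegeneratePair.essVars_eq (h : G.IsNondegeneratePair k l)
    (hG : ∀ x, ∃ y, G.Adj x y) : essVars (mergeVars G.edgeFn k l) = {l}ᶜ := by
  classical
  ext m
  rw [Set.mem_compl_singleton_iff]
  refine ⟨fun hm e => not_mem_essVars_mergeVars _ h.ne (e ▸ hm), fun hm => ?_⟩
  have witness : ∀ a : V → ZMod 2,
      mergeVars G.edgeFn k l (a + Pi.single m 1) = mergeVars G.edgeFn k l a + 1 →
      m ∈ essVars (mergeVars G.edgeFn k l) := by
    intro a ha
    refine ⟨a, a + Pi.single m 1, fun j hj => by simp [hj], ?_⟩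
    rw [ha]
    simp
  have hs : ∀ x, x ≠ k → x ≠ l → ∀ j, (if j = l then (Pi.single x 1 : V → ZMod 2) k
      else (Pi.single x 1 : V → ZMod 2) j) = if j = x then 1 else 0 := by
    intro x hk hl j
    by_cases hj : j = l
    · subst hj
      simp [hk.symm, hl.symm]
    · simp [hj, Pi.single_apply]
  by_cases hmk : m = k
  · subst hmk
    by_cases hml : G.Adj m l
    · refine witness 0 ?_
      rw [mergeVars_edgeFn_add_single_self _ h.ne]
      simp [adjVal_of_adj hml]
    · obtain ⟨x, hx⟩ := h.not_twins.resolve_left hml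
      have hxm : x ≠ m := by
        rintro rfl
        exact hx (iff_of_false (G.irrefl) fun e => hml e.symm)
      have hxl : x ≠ l := by
        rintro rfl
        exact hx (iff_of_false hml (G.irrefl))
      refine witness (Pi.single x 1) ?_
      rw [mergeVars_edgeFn_add_single_self _ h.ne]
      simp [hs x hxm hxl, adjVal_of_not_adj hml, adjVal_add_eq_one_iff.2 hx]
  · by_cases hj : ∃ j, G.Adj m j ∧ j ≠ k ∧ j ≠ l
    · obtain ⟨j, hmj, hjk, hjl⟩ := hj
      refine witness (Pi.single j 1) ?_
      rw [mergeVars_edgeFn_add_single_of_ne _ hmk hm]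
      simp [hs j hjk hjl, adjVal_of_adj hmj]
    -- All neighbours of `m` lie in `{k, l}`. Since that set is not its neighbourhood, `m` is
    -- adjacent to exactly one of the two, and switching `k` on detects it.
    · push Not at hj
      refine witness (Pi.single k 1) ?_
      rw [mergeVars_edgeFn_single_add_single h.ne hmk hm, mergeVars_edgeFn_single_self h.ne,
        adjVal_add_eq_one_iff.2]
      intro hiff
      obtain ⟨y, hy⟩ := hG m
      have hm_kl : G.Adj m k ∧ G.Adj m l := by
        rw [G.adj_comm k, G.adj_comm l] at hiff
        by_cases hyk : y = k
        · subst hyk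
          exact ⟨hy, hiff.1 hy⟩
        · have := hj y hy hyk
          subst this
          exact ⟨hiff.2 hy, hy⟩
      refine h.not_nbhd m fun x => ⟨fun hx => ?_, ?_⟩
      · by_cases hxk : x = k
        · exact .inl hxk
        · exact .inr (hj x hx hxk)
      · rintro (rfl | rfl)
        exacts [hm_kl.1, hm_kl.2]

/-- The smaller function already has `|V| - 1` essential variables, the most an identification can
have, so the comparison is an equivalence. -/
theorem IsNondegeneratePair.fnMinor_symm [Nonempty V] (h : G.IsNondegeneratePair k l)
    (hG : ∀ x, ∃ y, G.Adj x y) {i j : V} (hij : i ≠ j)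
    (hm : FnMinor (mergeVars G.edgeFn k l) (mergeVars G.edgeFn i j)) :
    FnMinor (mergeVars G.edgeFn i j) (mergeVars G.edgeFn k l) := by
  obtain ⟨σ, hσ⟩ := hm
  refine fnMinor_of_injOn hσ (injOn_essVars hσ ?_)
  have h1 : essVars (mergeVars G.edgeFn i j) ⊆ {j}ᶜ := fun x hx e =>
    not_mem_essVars_mergeVars _ hij (e ▸ hx)
  have h2 := Set.ncard_le_ncard h1 (Set.toFinite _)
  rw [h.essVars_eq hG]
  rw [Set.ncard_compl, Set.ncard_singleton] at h2 ⊢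
  exact h2

theorem IsNondegeneratePair.adj_and_ncard_le (h : G.IsNondegeneratePair k l) {k' l' : V}
    (h' : G.IsNondegeneratePair k' l') (hG : ∀ x, ∃ y, G.Adj x y)
    (hm : FnMinor (mergeVars G.edgeFn k' l') (mergeVars G.edgeFn k l)) (hkl : G.Adj k l) :
    G.Adj k' l' ∧ (G.distinguishing k l).ncard ≤ (G.distinguishing k' l').ncard := by
  classical
  obtain ⟨σ, hσ⟩ := hm
  have hinj : Set.InjOn σ {l}ᶜ := by
    rw [← h.essVars_eq hG]
    refine injOn_essVars hσ ?_
    rw [h.essVars_eq hG, h'.essVars_eq hG, Set.ncard_compl, Set.ncard_compl,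
      Set.ncard_singleton, Set.ncard_singleton]
  have hs : ∀ x, x ≠ l → ∀ i, i ≠ l →
      (Pi.single (σ x) 1 : V → ZMod 2) (σ i) = (Pi.single x 1 : V → ZMod 2) i := by
    intro x hx i hi
    by_cases hix : i = x
    · subst hix; simp
    · rw [Pi.single_eq_of_ne hix, Pi.single_eq_of_ne fun e => hix (hinj hi hx e)]
  have h1 : mergeVars G.edgeFn k' l' (Pi.single (σ k) 1) = 1 := by
    refine (hσ _).trans (Eq.trans ?_
      ((mergeVars_edgeFn_single_self h.ne).trans (adjVal_of_adj hkl)))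
    refine apply_eq_of_eqOn_essVars fun i hi => ?_
    rw [h.essVars_eq hG] at hi
    exact hs k h.ne i hi
  -- The only possible linear term of an identification is that of the merged variable.
  have hk : σ k = k' := by
    by_contra hne
    rw [mergeVars_edgeFn_single_of_ne h'.ne hne] at h1
    exact zero_ne_one h1
  have hadj : G.Adj k' l' := by
    by_contra hne
    rw [hk, mergeVars_edgeFn_single_self h'.ne, adjVal_of_not_adj hne] at h1
    exact zero_ne_one h1
  -- At `k` and `y` together the linear and quadratic terms cancel exactly when `y` distinguishes
  -- `k` from `l`; this vanishing is carried over by `σ`.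
  refine ⟨hadj, Set.ncard_le_ncard_of_injOn σ ?_ (hinj.mono fun y hy => hy.2.1) (Set.toFinite _)⟩
  rintro y ⟨hyk, hyl, hy⟩
  have hyk' : σ y ≠ k' := fun e => hyk (hinj hyl h.ne (e.trans hk.symm))
  have h2 : mergeVars G.edgeFn k' l' (Pi.single k' 1 + Pi.single (σ y) 1) = 0 := by
    have : mergeVars G.edgeFn k l (Pi.single k 1 + Pi.single y 1) = 0 := by
      rw [mergeVars_edgeFn_single_add_single h.ne hyk hyl, adjVal_add_eq_one_iff.2 hy,
        adjVal_of_adj hkl]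
      decide
    rw [hσ, ← this]
    refine apply_eq_of_eqOn_essVars fun i hi => ?_
    rw [h.essVars_eq hG] at hi
    rw [Pi.add_apply, Pi.add_apply, hs y hyl i hi, ← hk, hs k h.ne i hi]
  -- The variable `l'` no longer occurs, so switching it on would leave the value `1` of the linear
  -- term.
  have hyl' : σ y ≠ l' := by
    intro e
    have : mergeVars G.edgeFn k' l' (Pi.single k' 1 + Pi.single (σ y) 1) =
        mergeVars G.edgeFn k' l' (Pi.single k' 1) := by
      unfold mergeVars
      congr 1
      ext x
      by_cases hx : x = l'
      · simp [hx, e, h'.ne]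
      · simp [hx, e]
    rw [this, mergeVars_edgeFn_single_self h'.ne, adjVal_of_adj hadj] at h2
    exact one_ne_zero h2
  refine ⟨hyk', hyl', ?_⟩
  rw [mergeVars_edgeFn_single_add_single h'.ne hyk' hyl', adjVal_of_adj hadj] at h2
  refine adjVal_add_eq_one_iff.1 ?_
  generalize G.adjVal k' (σ y) + G.adjVal l' (σ y) = c at h2
  revert c
  decide

/-- The combinatorial content of join-irreducibility for a graph without isolated vertices. -/
theorem JoinIrreducible.adj_and_ncard_le [Nonempty V] (hJ : G.JoinIrreducible)
    (hG : ∀ x, ∃ y, G.Adj x y) (h : G.IsNondegeneratePair k l) {k' l' : V}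
    (h' : G.IsNondegeneratePair k' l') (hkl : G.Adj k l) :
    G.Adj k' l' ∧ (G.distinguishing k l).ncard ≤ (G.distinguishing k' l').ncard := by
  rw [joinIrreducible_iff_mergeVars] at hJ
  obtain ⟨i, -, j, -, hij, hmax⟩ := hJ
  refine h.adj_and_ncard_le h' hG ?_ hkl
  exact (hmax k' (hG k') l' (hG l') h'.ne).trans
    (h.fnMinor_symm hG hij (hmax k (hG k) l (hG l) h.ne))

end MergeVars

end SimpleGraph

/-! ### Classification of the graphs satisfying the combinatorial condition. -/

namespace SimpleGraph

/-- The graphs isomorphic to a disjoint union of at least two triangles, to `C₅`, to `K₂ + K̄ₘ` with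
`m ≥ 2`, to `Kₙ` with `n ≥ 2`, to `K̄ₙ + K̄ₘ` with `1 ≤ n < m`, or to `K̄ₙ + ⋯ + K̄ₙ` with
`r, n ≥ 2`. -/
def IsListed {V : Type*} (G : SimpleGraph V) : Prop :=
  (∃ n : ℕ, 2 ≤ n ∧ Nonempty (G ≃g disjointCopies n (completeGraph (Fin 3)))) ∨
  Nonempty (G ≃g cycleGraph 5) ∨
  (∃ m : ℕ, 2 ≤ m ∧ Nonempty (G ≃g graphJoin (completeGraph (Fin 2)) (edgeless m))) ∨
  (∃ n : ℕ, 2 ≤ n ∧ Nonempty (G ≃g completeGraph (Fin n))) ∨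
  (∃ n m : ℕ, 1 ≤ n ∧ n < m ∧ Nonempty (G ≃g graphJoin (edgeless n) (edgeless m))) ∨
  (∃ r n : ℕ, 2 ≤ r ∧ 2 ≤ n ∧ Nonempty (G ≃g joinCopies r (edgeless n)))

section Equivs

variable {V : Type*} [Finite V]

theorem exists_equiv_fin_prod (s : Setoid V) {m : ℕ} (h : ∀ x, {y | s y x}.ncard = m) :
    ∃ (r : ℕ) (e : V ≃ Fin r × Fin m), ∀ x y, (e x).1 = (e y).1 ↔ s x y := by
  have hf : ∀ q : Quotient s, Nonempty ({x // Quotient.mk s x = q} ≃ Fin m) := by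
    intro q
    induction q using Quotient.ind with
    | _ x =>
      refine ⟨Finite.equivFinOfCardEq ?_⟩
      rw [← h x, ← Nat.card_coe_set_eq]
      exact Nat.card_congr (Equiv.subtypeEquivRight fun y => Quotient.eq)
  let f := fun q => (hf q).some
  let e := ((Equiv.sigmaFiberEquiv (Quotient.mk s)).symm.trans (Equiv.sigmaCongrRight f)).trans
    ((Equiv.sigmaEquivProd _ _).trans (Equiv.prodCongr (Finite.equivFin _) (Equiv.refl _)))
  refine ⟨_, e, fun x y => ?_⟩
  have : ∀ z, (e z).1 = Finite.equivFin _ (Quotient.mk s z) := fun z => rfl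
  rw [this, this, EmbeddingLike.apply_eq_iff_eq]
  exact Quotient.eq

theorem exists_equiv_fin_sum (p : V → Prop) {n m : ℕ} (hn : {x | p x}.ncard = n)
    (hm : {x | ¬ p x}.ncard = m) :
    ∃ e : V ≃ Fin n ⊕ Fin m, ∀ x, (e x).isLeft = true ↔ p x := by
  classical
  let f : {x // p x} ≃ Fin n := Finite.equivFinOfCardEq (by rw [← hn, ← Nat.card_coe_set_eq]; rfl)
  let g : {x // ¬ p x} ≃ Fin m :=
    Finite.equivFinOfCardEq (by rw [← hm, ← Nat.card_coe_set_eq]; rfl)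
  refine ⟨(Equiv.sumCompl p).symm.trans (Equiv.sumCongr f g), fun x => ?_⟩
  by_cases hx : p x
  · simp [hx]
  · simp [hx]

end Equivs

theorem graphJoin_adj {V W : Type*} {G : SimpleGraph V} {H : SimpleGraph W} {x y : V ⊕ W} :
    (graphJoin G H).Adj x y ↔ (G.sum H).Adj x y ∨ (x.isLeft = true ↔ ¬ y.isLeft = true) := by
  rcases x with x | x <;> rcases y with y | y <;> simp [graphJoin]

theorem edgeless_adj {n : ℕ} (x y : Fin n) : ¬ (edgeless n).Adj x y := by
  simp [edgeless, completeGraph]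

section Classification

variable {V : Type*} {G : SimpleGraph V}

theorem isListed_of_adj_iff_ne [Finite V] [Nontrivial V] (h : ∀ x y, G.Adj x y ↔ x ≠ y) :
    G.IsListed := by
  refine .inr (.inr (.inr (.inl ⟨Nat.card V, Finite.one_lt_card, ⟨Finite.equivFin V, ?_⟩⟩)))
  intro x y
  simp [h]

theorem isListed_of_edges_nbhd [Finite V] [Nonempty V] (hG : ∀ x, ∃ y, G.Adj x y)
    (h : ∀ k l, G.Adj k l → ∃ w, ∀ x, G.Adj w x ↔ x = k ∨ x = l) : G.IsListed := by
  -- If `w` has neighbourhood `{x, y}`, the vertices whose neighbourhoods are the edges `yw` and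
  -- `xw` are neighbours of `w`, hence `x` and `y` themselves: the triangle is closed off.
  have hT : ∀ x y, G.Adj x y → ∃ w, (∀ z, G.Adj w z ↔ z = x ∨ z = y) ∧
      (∀ z, G.Adj x z ↔ z = y ∨ z = w) ∧ (∀ z, G.Adj y z ↔ z = x ∨ z = w) := by
    intro x y hxy
    obtain ⟨w, hw⟩ := h x y hxy
    have hwx : G.Adj w x := (hw x).2 (.inl rfl)
    have hwy : G.Adj w y := (hw y).2 (.inr rfl)
    obtain ⟨a, ha⟩ := h y w hwy.symm
    obtain ⟨b, hb⟩ := h x w hwx.symm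
    have ha1 : G.Adj a w := (ha w).2 (.inr rfl)
    have ha2 : G.Adj a y := (ha y).2 (.inl rfl)
    have hb1 : G.Adj b w := (hb w).2 (.inr rfl)
    have hb2 : G.Adj b x := (hb x).2 (.inl rfl)
    have hax : a = x := ((hw a).1 ha1.symm).resolve_right ha2.ne
    have hby : b = y := ((hw b).1 hb1.symm).resolve_left hb2.ne
    subst hax hby
    exact ⟨w, hw, ha, hb⟩
  let s : Setoid V :=
    { r := fun x y => x = y ∨ G.Adj x y
      iseqv := by
        refine ⟨fun x => .inl rfl, fun h => h.imp Eq.symm Adj.symm, ?_⟩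
        rintro x y z (rfl | hxy) (rfl | hyz)
        · exact .inl rfl
        · exact .inr hyz
        · exact .inr hxy
        · obtain ⟨w, -, h1, h2⟩ := hT x y hxy
          exact ((h2 z).1 hyz).imp Eq.symm fun e => (h1 z).2 (.inr e) }
  have hs : ∀ x y, s x y ↔ x = y ∨ G.Adj x y := fun _ _ => Iff.rfl
  have hcard : ∀ x, {y | s y x}.ncard = 3 := by
    intro x
    obtain ⟨y, hy⟩ := hG x
    obtain ⟨w, h1, h2, h3⟩ := hT x y hy
    rw [Set.ncard_eq_three]
    refine ⟨x, y, w, hy.ne, ((h1 x).2 (.inl rfl)).ne', ((h1 y).2 (.inr rfl)).ne', ?_⟩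
    ext z
    simp [hs, G.adj_comm z x, h2]
  obtain ⟨r, e, he⟩ := exists_equiv_fin_prod s hcard
  have hadj : ∀ x y, G.Adj x y ↔ x ≠ y ∧ (e x).1 = (e y).1 := by
    intro x y
    rw [he, hs]
    exact ⟨fun hxy => ⟨hxy.ne, .inr hxy⟩, fun hxy => hxy.2.resolve_left hxy.1⟩
  obtain ⟨x0⟩ := ‹Nonempty V›
  have hr : 0 < r := (Nat.zero_le _).trans_lt (e x0).1.2
  -- A single triangle is listed as a complete graph.
  by_cases hr1 : r = 1
  · subst hr1
    obtain ⟨y0, hy0⟩ := hG x0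
    have : Nontrivial V := ⟨x0, y0, hy0.ne⟩
    exact isListed_of_adj_iff_ne fun x y => by simp [hadj, Subsingleton.elim (e x).1 (e y).1]
  · refine .inl ⟨r, by omega, ⟨e, ?_⟩⟩
    intro x y
    rw [hadj, ← e.injective.ne_iff, Ne, Prod.ext_iff]
    simp only [disjointCopies, completeGraph, top_adj]
    tauto

theorem nonempty_iso_cycleGraph_five {w k x y l : V} (hkl : k ≠ l) (hkx : k ≠ x) (hky : k ≠ y)
    (hxl : x ≠ l) (hxw : x ≠ w) (hyw : y ≠ w)
    (hw : ∀ z, G.Adj w z ↔ z = k ∨ z = l) (hk : ∀ z, G.Adj k z ↔ z = x ∨ z = w)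
    (hx : ∀ z, G.Adj x z ↔ z = k ∨ z = y) (hy : ∀ z, G.Adj y z ↔ z = l ∨ z = x)
    (hl : ∀ z, G.Adj l z ↔ z = y ∨ z = w)
    (hV : ∀ z, z = w ∨ z = k ∨ z = x ∨ z = y ∨ z = l) : Nonempty (G ≃g cycleGraph 5) := by
  have hwk : w ≠ k := ((hw k).2 (.inl rfl)).ne
  have hwl : w ≠ l := ((hw l).2 (.inr rfl)).ne
  have hxy : x ≠ y := ((hx y).2 (.inr rfl)).ne
  have hyl : y ≠ l := ((hy l).2 (.inl rfl)).ne
  let f : Fin 5 → V := ![w, k, x, y, l]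
  have hf : Function.Bijective f := by
    constructor
    · intro a b
      fin_cases a <;> fin_cases b <;>
        simp [f, hkl, hkl.symm, hkx, hkx.symm, hky, hky.symm, hxl, hxl.symm, hxw, hxw.symm, hyw,
          hyw.symm, hwk, hwk.symm, hwl, hwl.symm, hxy, hxy.symm, hyl, hyl.symm]
    · intro z
      rcases hV z with rfl | rfl | rfl | rfl | rfl
      exacts [⟨0, rfl⟩, ⟨1, rfl⟩, ⟨2, rfl⟩, ⟨3, rfl⟩, ⟨4, rfl⟩]
  refine ⟨RelIso.symm ⟨Equiv.ofBijective f hf, ?_⟩⟩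
  intro a b
  fin_cases a <;> fin_cases b <;>
    simp [f, hw, hk, hx, hy, hl, hkl, hkl.symm, hkx, hkx.symm, hky, hky.symm, hxl, hxl.symm, hxw,
      hxw.symm, hyw, hyw.symm, hwk, hwk.symm, hwl, hwl.symm, hxy, hxy.symm, hyl, hyl.symm,
      cycleGraph_adj] <;> decide

/-- The path `x, k, w, l` closes up through a vertex `y` with neighbourhood `{l, x}`, because `w`
separates `l` from `x`. A sixth vertex, being nonadjacent to `w`, would be a twin of `w` or a
neighbour of `k` or `l`, whose neighbourhoods are already full. -/
theorem nonempty_iso_cycleGraph_five_of_nbhd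
    (hN : ∀ u v, u ≠ v → ¬ G.Adj u v →
      (∃ w, ∀ x, G.Adj w x ↔ x = u ∨ x = v) ∨ ∀ x, G.Adj u x ↔ G.Adj v x)
    {k l w x : V} (hkl : k ≠ l) (hnkl : ¬ G.Adj k l) (hw : ∀ z, G.Adj w z ↔ z = k ∨ z = l)
    (hxw : x ≠ w) (hlx : ¬ G.Adj l x) (hk : ∀ z, G.Adj k z ↔ z = x ∨ z = w) :
    Nonempty (G ≃g cycleGraph 5) := by
  have hother : ∀ v, v ≠ w → v ≠ k → v ≠ l → (∀ z, G.Adj v z ↔ G.Adj w z) ∨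
      (∀ z, G.Adj k z ↔ z = v ∨ z = w) ∨ (∀ z, G.Adj l z ↔ z = v ∨ z = w) := by
    intro v hvw hvk hvl
    have hnvw : ¬ G.Adj v w := fun e => ((hw v).1 e.symm).elim hvk hvl
    rcases hN v w hvw hnvw with ⟨u, hu⟩ | h
    · rcases (hw u).1 ((hu w).2 (.inr rfl)).symm with rfl | rfl
      · exact .inr (.inl hu)
      · exact .inr (.inr hu)
    · exact .inl h
  have hkx : G.Adj k x := (hk x).2 (.inl rfl)
  have hwk : G.Adj w k := (hw k).2 (.inl rfl)
  have hwl : G.Adj w l := (hw l).2 (.inr rfl)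
  have hxl : x ≠ l := fun e => hnkl (e ▸ hkx)
  have hnxw : ¬ G.Adj w x := fun e => ((hw x).1 e).elim hkx.ne' hxl
  obtain ⟨y, hy⟩ : ∃ y, ∀ z, G.Adj y z ↔ z = l ∨ z = x :=
    (hN l x hxl.symm hlx).resolve_right fun e => hnxw ((e w).1 hwl.symm).symm
  have hyl : G.Adj y l := (hy l).2 (.inl rfl)
  have hyx : G.Adj y x := (hy x).2 (.inr rfl)
  have hyw : y ≠ w := by
    rintro rfl
    exact hnxw hyx
  have hyk : y ≠ k := by
    rintro rfl
    exact hnkl hyl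
  have hl : ∀ z, G.Adj l z ↔ z = y ∨ z = w := by
    rcases hother y hyw hyk hyl.ne with h | h | h
    · exact absurd ((hy k).1 ((h k).2 hwk)) (not_or.2 ⟨hkl, hkx.ne⟩)
    · exact absurd ((h x).1 hkx) (not_or.2 ⟨hyx.ne', hxw⟩)
    · exact h
  have hrest : ∀ z, z = w ∨ z = k ∨ z = x ∨ z = y ∨ z = l := by
    intro z
    by_contra! hz
    obtain ⟨hzw, hzk, hzx, hzy, hzl⟩ := hz
    rcases hother z hzw hzk hzl with h | h | h
    · exact ((hk z).1 ((h k).2 hwk).symm).elim hzx hzw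
    · exact ((hk z).1 ((h z).2 (.inl rfl))).elim hzx hzw
    · exact ((hl z).1 ((h z).2 (.inl rfl))).elim hzy hzw
  refine nonempty_iso_cycleGraph_five hkl hkx.ne hyk.symm hxl hxw hyw hw hk (fun z => ?_) hy hl
    hrest
  constructor
  · intro hz
    rcases hrest z with rfl | rfl | rfl | rfl | rfl
    · exact absurd hz.symm hnxw
    · exact .inl rfl
    · exact absurd hz G.irrefl
    · exact .inr rfl
    · exact absurd hz.symm hlx
  · rintro (rfl | rfl)
    exacts [hkx.symm, hyx.symm]

theorem nonempty_iso_cycleGraph_five_of_not_twins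
    (hN : ∀ u v, u ≠ v → ¬ G.Adj u v →
      (∃ w, ∀ x, G.Adj w x ↔ x = u ∨ x = v) ∨ ∀ x, G.Adj u x ↔ G.Adj v x)
    {k l : V} (hkl : k ≠ l) (hnkl : ¬ G.Adj k l) (ht : ¬ ∀ x, G.Adj k x ↔ G.Adj l x) :
    Nonempty (G ≃g cycleGraph 5) := by
  obtain ⟨w, hw⟩ := (hN k l hkl hnkl).resolve_right ht
  obtain ⟨x, hx⟩ := not_forall.1 ht
  have hwk : G.Adj w k := (hw k).2 (.inl rfl)
  have hwl : G.Adj w l := (hw l).2 (.inr rfl)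
  have hxw : x ≠ w := by
    rintro rfl
    exact hx (iff_of_true hwk.symm hwl.symm)
  have hxk : x ≠ k := by
    rintro rfl
    exact hx (iff_of_false G.irrefl fun e => hnkl e.symm)
  have hxl : x ≠ l := by
    rintro rfl
    exact hx (iff_of_false hnkl G.irrefl)
  -- Here `x` separates `k` from `l` while `w` is adjacent to both, so `x` and `w` are not twins and
  -- `{x, w}` is the neighbourhood of `k` or of `l`.
  have hnxw : ¬ G.Adj x w := fun e => ((hw x).1 e.symm).elim hxk hxl
  rcases hN x w hxw hnxw with ⟨u, hu⟩ | h
  · rcases (hw u).1 ((hu w).2 (.inr rfl)).symm with rfl | rfl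
    · exact nonempty_iso_cycleGraph_five_of_nbhd hN hkl hnkl hw hxw
        (fun e => hx (iff_of_true ((hu x).2 (.inl rfl)) e)) hu
    · exact nonempty_iso_cycleGraph_five_of_nbhd hN hkl.symm (fun e => hnkl e.symm)
        (fun z => (hw z).trans or_comm) hxw
        (fun e => hx (iff_of_true e ((hu x).2 (.inl rfl)))) hu
  · exact absurd (iff_of_true ((h k).2 hwk).symm ((h l).2 hwl).symm) hx

/-- By `hT` nonadjacency is an equivalence relation, so the graph is complete multipartite and only
the part sizes are in question. -/
theorem isListed_of_twins [Finite V] {k0 l0 : V} (h0 : G.Adj k0 l0)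
    (hT : ∀ u v, ¬ G.Adj u v → ∀ x, G.Adj u x ↔ G.Adj v x)
    (hD : ∀ k l k' l', G.IsNondegeneratePair k l → G.IsNondegeneratePair k' l' → G.Adj k l →
      (G.distinguishing k l).ncard ≤ (G.distinguishing k' l').ncard) : G.IsListed := by
  have : Nontrivial V := ⟨k0, l0, h0.ne⟩
  by_cases hbad : ∃ k l w, G.Adj k l ∧ ∀ x, G.Adj w x ↔ x = k ∨ x = l
  · obtain ⟨k, l, w, hkl, hw⟩ := hbad
    -- A vertex outside `{k, l}` is nonadjacent to `w`, hence its twin.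
    have hout : ∀ u, ¬ (u = k ∨ u = l) → ∀ v, G.Adj u v ↔ v = k ∨ v = l := fun u hu v =>
      (hT u w (fun e => hu ((hw u).1 e.symm)) v).trans (hw v)
    have hadj : ∀ u v, G.Adj u v ↔ u ≠ v ∧ ((u = k ∨ u = l) ∨ (v = k ∨ v = l)) := by
      intro u v
      by_cases hu : u = k ∨ u = l
      · by_cases hv : v = k ∨ v = l
        · refine ⟨fun e => ⟨e.ne, .inl hu⟩, fun e => ?_⟩
          rcases hu with rfl | rfl <;> rcases hv with rfl | rfl
          exacts [absurd rfl e.1, hkl, hkl.symm, absurd rfl e.1]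
        · rw [G.adj_comm, hout v hv]
          exact ⟨fun e => ⟨fun e' => hv (e' ▸ e), .inl e⟩, fun _ => hu⟩
      · rw [hout u hu]
        exact ⟨fun e => ⟨fun e' => hu (e' ▸ e), .inr e⟩, fun e => e.2.resolve_left hu⟩
    obtain ⟨e, he⟩ := exists_equiv_fin_sum (fun x => x = k ∨ x = l)
      (show {x | x = k ∨ x = l}.ncard = 2 from Set.ncard_pair hkl.ne) rfl
    by_cases hm : 2 ≤ {x | ¬ (x = k ∨ x = l)}.ncard
    · refine .inr (.inr (.inl ⟨_, hm, ⟨e, ?_⟩⟩))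
      intro u v
      rw [graphJoin_adj, hadj, ← he, ← he, ← e.injective.ne_iff]
      rcases e u with a | a <;> rcases e v with b | b <;> simp [completeGraph]
    · refine isListed_of_adj_iff_ne fun u v => ?_
      rw [hadj]
      refine ⟨fun e => e.1, fun e => ⟨e, ?_⟩⟩
      by_contra hc
      rw [not_or] at hc
      refine hm (Set.one_lt_ncard (Set.toFinite _) |>.2 ⟨u, hc.1, v, hc.2, e⟩)
  · have hnd : ∀ k l, G.Adj k l → G.IsNondegeneratePair k l := fun k l h =>
      ⟨h.ne, fun w hw => hbad ⟨k, l, w, h, hw⟩, .inl h⟩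
    -- The vertices distinguishing `k` from `l` are those of their two parts other than `k` and `l`.
    -- So the sum of the two part sizes is the same for all edges.
    have hcl : ∀ k l, G.Adj k l → {y | ¬ G.Adj k y}.ncard + {y | ¬ G.Adj l y}.ncard =
        (G.distinguishing k l).ncard + 2 := by
      intro k l hkl
      rw [← Set.ncard_union_eq ?_ (Set.toFinite _) (Set.toFinite _)]
      · have : {y | ¬ G.Adj k y} ∪ {y | ¬ G.Adj l y} =
            insert k (insert l (G.distinguishing k l)) := by
          ext y
          simp only [Set.mem_union, Set.mem_insert_iff, Set.mem_ofPred_eq, distinguishing]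
          by_cases hyk : y = k
          · subst hyk; simp
          · by_cases hyl : y = l
            · subst hyl; simp
            · have := hT k y
              have := hT l y
              have := hkl.symm
              have := G.adj_comm y l
              grind
        rw [this, Set.ncard_insert_of_notMem, Set.ncard_insert_of_notMem]
        · exact fun h => h.2.1 rfl
        · rintro (h | h)
          exacts [hkl.ne h, h.1 rfl]
      · rw [Set.disjoint_left]
        intro y hk hl
        exact hl ((hT k y hk l).1 hkl).symm
    have hconst : ∀ k l k' l', G.Adj k l → G.Adj k' l' →
        {y | ¬ G.Adj k y}.ncard + {y | ¬ G.Adj l y}.ncard =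
          {y | ¬ G.Adj k' y}.ncard + {y | ¬ G.Adj l' y}.ncard := by
      intro k l k' l' h h'
      rw [hcl k l h, hcl k' l' h']
      have h1 := hD k l k' l' (hnd _ _ h) (hnd _ _ h') h
      have h2 := hD k' l' k l (hnd _ _ h') (hnd _ _ h) h'
      omega
    by_cases heq : ∀ x y, G.Adj x y → {z | ¬ G.Adj x z}.ncard = {z | ¬ G.Adj y z}.ncard
    · let s : Setoid V :=
        { r := fun x y => ¬ G.Adj x y
          iseqv := ⟨fun x => G.irrefl, fun h e => h e.symm,
            fun {x y z} hxy hyz e => hyz ((hT x y hxy z).1 e)⟩ }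
      have hs : ∀ x y, s x y ↔ ¬ G.Adj x y := fun _ _ => Iff.rfl
      have hcard : ∀ x, {y | s y x}.ncard = {y | ¬ G.Adj k0 y}.ncard := by
        intro x
        have : {y | s y x} = {y | ¬ G.Adj x y} := by
          ext y
          simp [hs, G.adj_comm]
        rw [this]
        by_cases hx : G.Adj x k0
        · exact heq x k0 hx
        · simp only [hT x k0 hx]
      obtain ⟨r, e, he⟩ := exists_equiv_fin_prod s hcard
      have hadj : ∀ x y, G.Adj x y ↔ (e x).1 ≠ (e y).1 := fun x y => by
        rw [Ne, he, hs, not_not]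
      have hr : 2 ≤ r := by
        by_contra hr
        refine (hadj k0 l0).1 h0 ?_
        have := (e k0).1.2
        have := (e l0).1.2
        ext
        omega
      by_cases hn : 2 ≤ {y | ¬ G.Adj k0 y}.ncard
      · refine .inr (.inr (.inr (.inr (.inr ⟨r, _, hr, hn, ⟨e, ?_⟩⟩))))
        intro x y
        rw [hadj]
        simp [joinCopies]
      · refine isListed_of_adj_iff_ne fun x y => ?_
        rw [hadj, ← e.injective.ne_iff]
        refine not_congr ⟨fun h => Prod.ext h ?_, fun h => congrArg _ h⟩
        have := (e x).2.2
        have := (e y).2.2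
        ext
        omega
    · push Not at heq
      obtain ⟨x, y, hxy, hlt⟩ : ∃ x y, G.Adj x y ∧
          {z | ¬ G.Adj x z}.ncard < {z | ¬ G.Adj y z}.ncard := by
        obtain ⟨x, y, hxy, hne⟩ := heq
        rcases lt_or_gt_of_ne hne with h | h
        exacts [⟨x, y, hxy, h⟩, ⟨y, x, hxy.symm, h⟩]
      -- A vertex adjacent to both `x` and `y` would give edges to two parts of different sizes with
      -- equal sums; so there are only two parts.
      have hz : ∀ z, ¬ G.Adj x z ↔ G.Adj y z := by
        intro z
        constructor
        · intro h
          exact ((hT x z h y).1 hxy).symm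
        · intro h h'
          have := hconst x z y z h' h
          omega
      have hset : {z | ¬ ¬ G.Adj x z} = {z | ¬ G.Adj y z} := by
        ext z
        simp only [hz, Set.mem_ofPred_eq]
      obtain ⟨e, he⟩ := exists_equiv_fin_sum (fun z => ¬ G.Adj x z) rfl
        (congrArg Set.ncard hset)
      have hadj : ∀ u v, G.Adj u v ↔ (¬ G.Adj x u ↔ ¬ ¬ G.Adj x v) := by
        intro u v
        by_cases hu : G.Adj x u
        · have huy : ¬ G.Adj y u := fun e => (hz u).2 e hu
          rw [← hT y u huy v, ← hz]
          simp [hu]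
        · rw [← hT x u hu v]
          simp [hu]
      have hpos : 1 ≤ {z | ¬ G.Adj x z}.ncard :=
        (Set.ncard_pos (Set.toFinite _)).2 ⟨x, G.irrefl⟩
      refine .inr (.inr (.inr (.inr (.inl ⟨_, _, hpos, hlt, ⟨e, ?_⟩⟩))))
      intro u v
      rw [graphJoin_adj, hadj, ← he, ← he]
      rcases e u with a | a <;> rcases e v with b | b <;> simp

theorem isListed_of_nondegeneratePairs [Finite V] [Nonempty V] (hG : ∀ x, ∃ y, G.Adj x y)
    (hD : ∀ k l k' l', G.IsNondegeneratePair k l → G.IsNondegeneratePair k' l' → G.Adj k l →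
      G.Adj k' l' ∧ (G.distinguishing k l).ncard ≤ (G.distinguishing k' l').ncard) :
    G.IsListed := by
  by_cases h : ∃ k l, G.IsNondegeneratePair k l ∧ G.Adj k l
  · obtain ⟨k0, l0, hnd, h0⟩ := h
    have hN : ∀ u v, u ≠ v → ¬ G.Adj u v →
        (∃ w, ∀ x, G.Adj w x ↔ x = u ∨ x = v) ∨ ∀ x, G.Adj u x ↔ G.Adj v x := by
      intro u v huv hadj
      by_contra! hc
      refine hadj (hD k0 l0 u v hnd ⟨huv, fun w hw => ?_, .inr ?_⟩ h0).1
      · obtain ⟨x, hx⟩ := hc.1 w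
        have := hw x
        tauto
      · obtain ⟨x, hx⟩ := hc.2
        exact ⟨x, by tauto⟩
    by_cases ht : ∀ u v, ¬ G.Adj u v → ∀ x, G.Adj u x ↔ G.Adj v x
    · exact isListed_of_twins h0 ht fun k l k' l' h1 h2 h3 => (hD k l k' l' h1 h2 h3).2
    · simp only [not_forall] at ht
      obtain ⟨u, v, huv, x, hx⟩ := ht
      have hne : u ≠ v := fun e => hx (by rw [e])
      exact .inr (.inl (nonempty_iso_cycleGraph_five_of_not_twins hN hne huv fun e => hx (e x)))
  · refine isListed_of_edges_nbhd hG fun k l hkl => ?_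
    by_contra hc
    exact h ⟨k, l, ⟨hkl.ne, fun w hw => hc ⟨w, hw⟩, .inl hkl⟩, hkl⟩

end Classification

end SimpleGraph

/-! ### The converse: a greatest identification in each listed graph. -/

theorem mergeVars_fnMinor_comm {α : Type*} (f : (α → ZMod 2) → ZMod 2) (k l : α) :
    FnMinor (mergeVars f k l) (mergeVars f l k) := by
  classical
  refine fnMinor_mergeVars_of_apply_eq (σ := fun x => if x = l then k else x) (fun a => ?_) ?_
  · unfold mergeVars
    congr 1
    ext x
    split_ifs <;> rfl
  · by_cases h : k = l <;> simp [h]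

theorem exists_perm_apply_eq_apply_eq {α : Type*} {p p' s s' : α} (h : p ≠ p') (h' : s ≠ s') :
    ∃ φ : Equiv.Perm α, φ p = s ∧ φ p' = s' := by
  classical
  refine ⟨(Equiv.swap p s).trans (Equiv.swap (Equiv.swap p s p') s'), ?_, ?_⟩
  · rw [Equiv.trans_apply, Equiv.swap_apply_left, Equiv.swap_apply_of_ne_of_ne _ h']
    exact fun e => h ((Equiv.swap p s).injective ((Equiv.swap_apply_left p s).trans e))
  · simp

/-- Permute the blocks, then correct by swaps inside each block; the block relation is untouched, so
this is an automorphism of any graph defined from it. -/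
theorem exists_perm_prod {α β : Type*} {p p' s s' : α} (h : p ≠ p') (h' : s ≠ s')
    (x x' y y' : β) : ∃ φ : Equiv.Perm (α × β), φ (p, x) = (s, y) ∧ φ (p', x') = (s', y') ∧
      ∀ u v, (φ u).1 = (φ v).1 ↔ u.1 = v.1 := by
  classical
  obtain ⟨φ, h1, h2⟩ := exists_perm_apply_eq_apply_eq h h'
  refine ⟨Equiv.prodShear φ fun q => if q = p then Equiv.swap x y else Equiv.swap x' y',
    ?_, ?_, ?_⟩
  · simp [h1]
  · simp [h2, h.symm]
  · simp

namespace SimpleGraph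

section MaximalPair

variable {V : Type*} [Fintype V] {G : SimpleGraph V}

theorem mergeVars_fnMinor_of_iso (φ : G ≃g G) {i j k l : V} (hi : φ i = k) (hj : φ j = l) :
    FnMinor (mergeVars G.edgeFn k l) (mergeVars G.edgeFn i j) :=
  mergeVars_fnMinor_of_perm φ (edgeFn_comp_iso φ) hi hj

theorem mergeVars_fnMinor_of_nbhd {k l w : V} (u : V) (h : k ≠ l)
    (hw : ∀ x, G.Adj w x ↔ x = k ∨ x = l) :
    FnMinor (mergeVars G.edgeFn k l) (mergeVars G.edgeFn w u) :=
  mergeVars_fnMinor_of_not_mem (not_mem_essVars_of_nbhd h hw) ((hw l).2 (.inr rfl)).ne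

theorem mergeVars_fnMinor_of_twins {k l : V} (u : V) (h : k ≠ l) (hkl : ¬ G.Adj k l)
    (ht : ∀ x, G.Adj k x ↔ G.Adj l x) :
    FnMinor (mergeVars G.edgeFn k l) (mergeVars G.edgeFn k u) :=
  mergeVars_fnMinor_of_not_mem (not_mem_essVars_of_twins h hkl ht) h

theorem joinIrreducible_of_forall_fnMinor [Nonempty V] (hG : ∀ x, ∃ y, G.Adj x y) {i j : V}
    (hij : i ≠ j) (h : ∀ k l, k ≠ l → FnMinor (mergeVars G.edgeFn k l) (mergeVars G.edgeFn i j)) :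
    G.JoinIrreducible :=
  G.joinIrreducible_iff_mergeVars.2 ⟨i, hG i, j, hG j, hij, fun k _ l _ hkl => h k l hkl⟩

end MaximalPair

theorem joinIrreducible_completeGraph {n : ℕ} [Nonempty (Fin n)] (hn : 2 ≤ n) :
    (completeGraph (Fin n)).JoinIrreducible := by
  have : Nontrivial (Fin n) := Fin.nontrivial_iff_two_le.2 hn
  obtain ⟨i, j, hij⟩ := exists_pair_ne (Fin n)
  refine joinIrreducible_of_forall_fnMinor (fun x => ?_) hij fun k l hkl => ?_
  · obtain ⟨y, hy⟩ := exists_ne x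
    exact ⟨y, hy.symm⟩
  · obtain ⟨φ, h1, h2⟩ := exists_perm_apply_eq_apply_eq hij hkl
    exact mergeVars_fnMinor_of_iso ⟨φ, by simp [completeGraph]⟩ h1 h2

theorem joinIrreducible_cycleGraph_five : (cycleGraph 5).JoinIrreducible := by
  have hadj : ∀ a b : Fin 5, (cycleGraph 5).Adj a b ↔ a - b = 1 ∨ b - a = 1 := fun a b =>
    cycleGraph_adj
  have h1 : ∀ k : Fin 5, FnMinor (mergeVars (cycleGraph 5).edgeFn k (k + 1))
      (mergeVars (cycleGraph 5).edgeFn 0 1) := fun k =>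
    mergeVars_fnMinor_of_iso ⟨Equiv.addRight k, by simp [hadj]⟩ (by simp) (by simp [add_comm])
  -- Vertices at distance two form the neighbourhood of the vertex between them, so their
  -- identification lies below that of an edge.
  have h2 : ∀ k : Fin 5, FnMinor (mergeVars (cycleGraph 5).edgeFn k (k + 2))
      (mergeVars (cycleGraph 5).edgeFn 0 1) := fun k =>
    (mergeVars_fnMinor_of_nbhd (w := k + 1) k (by revert k; decide)
      (fun x => by rw [hadj]; revert k x; decide)).trans
      ((mergeVars_fnMinor_comm _ _ _).trans (h1 k))
  refine joinIrreducible_of_forall_fnMinor (fun x => ⟨x + 1, (hadj _ _).2 (by simp)⟩)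
    zero_ne_one fun k l hkl => ?_
  have : l = k + 1 ∨ l = k + 2 ∨ k = l + 1 ∨ k = l + 2 := by revert k l; decide
  rcases this with rfl | rfl | rfl | rfl
  · exact h1 k
  · exact h2 k
  · exact (mergeVars_fnMinor_comm _ _ _).trans (h1 l)
  · exact (mergeVars_fnMinor_comm _ _ _).trans (h2 l)

section GraphJoinAdj

variable {α β : Type*} {G : SimpleGraph α} {H : SimpleGraph β}

theorem graphJoin_adj_inl_inr (x : α) (y : β) : (graphJoin G H).Adj (.inl x) (.inr y) := by
  simp [graphJoin]

theorem graphJoin_adj_inr_inl (x : α) (y : β) : (graphJoin G H).Adj (.inr y) (.inl x) := by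
  simp [graphJoin]

theorem graphJoin_adj_inl_inl {x y : α} :
    (graphJoin G H).Adj (.inl x) (.inl y) ↔ G.Adj x y := by
  simp [graphJoin]

theorem graphJoin_adj_inr_inr {x y : β} :
    (graphJoin G H).Adj (.inr x) (.inr y) ↔ H.Adj x y := by
  simp [graphJoin]

theorem exists_graphJoin_adj [Nonempty α] [Nonempty β] (x : α ⊕ β) :
    ∃ y, (graphJoin G H).Adj x y := by
  obtain ⟨a⟩ := ‹Nonempty α›
  obtain ⟨b⟩ := ‹Nonempty β›
  rcases x with x | x
  exacts [⟨_, graphJoin_adj_inl_inr x b⟩, ⟨_, graphJoin_adj_inr_inl a x⟩]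

end GraphJoinAdj

section GraphJoin

variable {α β : Type*} [Fintype α] [Fintype β] {G : SimpleGraph α} {H : SimpleGraph β}

theorem mergeVars_graphJoin_fnMinor (hG : ∀ (φ : Equiv.Perm α) x y, G.Adj (φ x) (φ y) ↔ G.Adj x y)
    (hH : ∀ (φ : Equiv.Perm β) x y, H.Adj (φ x) (φ y) ↔ H.Adj x y) (a a' : α) (b b' : β) :
    FnMinor (mergeVars (graphJoin G H).edgeFn (.inl a') (.inr b'))
      (mergeVars (graphJoin G H).edgeFn (.inl a) (.inr b)) := by
  classical
  refine mergeVars_fnMinor_of_iso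
    ⟨Equiv.sumCongr (Equiv.swap a a') (Equiv.swap b b'), ?_⟩
    (congrArg Sum.inl (Equiv.swap_apply_left a a')) (congrArg Sum.inr (Equiv.swap_apply_left b b'))
  rintro (x | x) (y | y)
  · exact graphJoin_adj_inl_inl.trans ((hG _ _ _).trans graphJoin_adj_inl_inl.symm)
  · exact iff_of_true (graphJoin_adj_inl_inr _ _) (graphJoin_adj_inl_inr _ _)
  · exact iff_of_true (graphJoin_adj_inr_inl _ _) (graphJoin_adj_inr_inl _ _)
  · exact graphJoin_adj_inr_inr.trans ((hH _ _ _).trans graphJoin_adj_inr_inr.symm)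

theorem mergeVars_graphJoin_fnMinor_inl_inl (hG : ∀ x y, ¬ G.Adj x y) {a a' : α} (h : a ≠ a')
    (b : β) : FnMinor (mergeVars (graphJoin G H).edgeFn (.inl a) (.inl a'))
      (mergeVars (graphJoin G H).edgeFn (.inl a) (.inr b)) := by
  refine mergeVars_fnMinor_of_twins _ (by simpa using h)
    (fun e => hG _ _ (graphJoin_adj_inl_inl.1 e)) ?_
  rintro (x | x)
  · exact iff_of_false (fun e => hG _ _ (graphJoin_adj_inl_inl.1 e))
      fun e => hG _ _ (graphJoin_adj_inl_inl.1 e)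
  · exact iff_of_true (graphJoin_adj_inl_inr _ _) (graphJoin_adj_inl_inr _ _)

theorem mergeVars_graphJoin_fnMinor_inr_inr (hH : ∀ x y, ¬ H.Adj x y) {b b' : β} (h : b ≠ b')
    (a : α) : FnMinor (mergeVars (graphJoin G H).edgeFn (.inr b) (.inr b'))
      (mergeVars (graphJoin G H).edgeFn (.inl a) (.inr b)) := by
  refine FnMinor.trans ?_ (mergeVars_fnMinor_comm (graphJoin G H).edgeFn (.inr b) (.inl a))
  refine mergeVars_fnMinor_of_twins _ (Sum.inr_injective.ne h)
    (fun e => hH _ _ (graphJoin_adj_inr_inr.1 e)) ?_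
  rintro (x | x)
  · exact iff_of_true (graphJoin_adj_inr_inl _ _) (graphJoin_adj_inr_inl _ _)
  · exact iff_of_false (fun e => hH _ _ (graphJoin_adj_inr_inr.1 e))
      fun e => hH _ _ (graphJoin_adj_inr_inr.1 e)

/-- Pairs across the join are all equivalent by symmetry and are the greatest; pairs on the right
are nonadjacent twins. Pairs on the left are left to `hl`: they are twins if `G` is edgeless, and
the neighbourhood of a right vertex if `G` is `K₂`. -/
theorem joinIrreducible_graphJoin [Nonempty α] [Nonempty β]
    (hG : ∀ (φ : Equiv.Perm α) x y, G.Adj (φ x) (φ y) ↔ G.Adj x y) (hH : ∀ x y, ¬ H.Adj x y)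
    (hl : ∀ a a', a ≠ a' → ∃ a'' b'',
      FnMinor (mergeVars (graphJoin G H).edgeFn (.inl a) (.inl a'))
        (mergeVars (graphJoin G H).edgeFn (.inl a'') (.inr b''))) :
    (graphJoin G H).JoinIrreducible := by
  obtain ⟨a0⟩ := ‹Nonempty α›
  obtain ⟨b0⟩ := ‹Nonempty β›
  have key := mergeVars_graphJoin_fnMinor hG
    (fun φ x y => iff_of_false (hH (φ x) (φ y)) (hH x y)) a0
  refine joinIrreducible_of_forall_fnMinor exists_graphJoin_adj
    (i := .inl a0) (j := .inr b0) (by simp) ?_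
  rintro (a | b) (a' | b') hkl
  · obtain ⟨a'', b'', h⟩ := hl a a' (by simpa using hkl)
    exact h.trans (key a'' b0 b'')
  · exact key a b0 b'
  · exact (mergeVars_fnMinor_comm _ _ _).trans (key a' b0 b)
  · exact (mergeVars_graphJoin_fnMinor_inr_inr hH (by simpa using hkl) a0).trans (key a0 b0 b)

end GraphJoin

theorem joinIrreducible_graphJoin_edgeless {n m : ℕ} [Nonempty (Fin n)] [Nonempty (Fin m)] :
    (graphJoin (edgeless n) (edgeless m)).JoinIrreducible := by
  obtain ⟨b⟩ := ‹Nonempty (Fin m)›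
  exact joinIrreducible_graphJoin
    (fun φ x y => iff_of_false (edgeless_adj _ _) (edgeless_adj _ _)) edgeless_adj
    fun a a' h => ⟨a, b, mergeVars_graphJoin_fnMinor_inl_inl edgeless_adj h b⟩

theorem joinIrreducible_graphJoin_completeGraph_two {m : ℕ} [Nonempty (Fin m)] :
    (graphJoin (completeGraph (Fin 2)) (edgeless m)).JoinIrreducible := by
  obtain ⟨b⟩ := ‹Nonempty (Fin m)›
  refine joinIrreducible_graphJoin (fun φ x y => by simp [completeGraph]) edgeless_adj
    fun a a' h => ⟨a, b, ?_⟩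
  refine FnMinor.trans ?_ (mergeVars_fnMinor_comm (graphJoin _ _).edgeFn (.inr b) (.inl a))
  refine mergeVars_fnMinor_of_nbhd _ (Sum.inl_injective.ne h) ?_
  rintro (x | x)
  · refine iff_of_true (graphJoin_adj_inr_inl _ _) ?_
    simp only [Sum.inl.injEq]
    omega
  · exact iff_of_false (fun e => edgeless_adj _ _ (graphJoin_adj_inr_inr.1 e)) (by simp)

theorem joinIrreducible_disjointCopies {n : ℕ} [Nonempty (Fin n)] (hn : 2 ≤ n) :
    (disjointCopies n (completeGraph (Fin 3))).JoinIrreducible := by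
  have hadj : ∀ u v, (disjointCopies n (completeGraph (Fin 3))).Adj u v ↔
      u ≠ v ∧ u.1 = v.1 := by
    intro u v
    rw [Ne, Prod.ext_iff]
    simp only [disjointCopies, completeGraph, top_adj]
    tauto
  have : Nontrivial (Fin n) := Fin.nontrivial_iff_two_le.2 hn
  obtain ⟨p, q, hpq⟩ := exists_pair_ne (Fin n)
  have key : ∀ k l : Fin n × Fin 3, k.1 ≠ l.1 →
      FnMinor (mergeVars (disjointCopies n (completeGraph (Fin 3))).edgeFn k l)
        (mergeVars (disjointCopies n (completeGraph (Fin 3))).edgeFn (p, 0) (q, 0)) := by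
    intro k l hkl
    obtain ⟨φ, h1, h2, h3⟩ := exists_perm_prod hpq hkl 0 0 k.2 l.2
    exact mergeVars_fnMinor_of_iso ⟨φ, by simp [hadj, h3]⟩ h1 h2
  refine joinIrreducible_of_forall_fnMinor (fun x => ?_) (i := (p, 0)) (j := (q, 0))
    (by simpa using hpq) fun k l hkl => ?_
  · obtain ⟨y, hy⟩ := exists_ne x.2
    exact ⟨(x.1, y), (hadj _ _).2 ⟨fun e => hy (congrArg Prod.snd e).symm, rfl⟩⟩
  · by_cases h : k.1 = l.1
    · obtain ⟨s, x⟩ := k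
      obtain ⟨s', x'⟩ := l
      obtain rfl : s = s' := h
      have hx : x ≠ x' := fun e => hkl (e ▸ rfl)
      -- Two vertices of one triangle are the neighbourhood of its third vertex, which can be paired
      -- with a vertex of another triangle.
      obtain ⟨y, hy⟩ : ∃ y : Fin 3, ∀ z, z ≠ y ↔ z = x ∨ z = x' := by
        clear hkl
        revert x x'
        decide
      obtain ⟨t, ht⟩ := exists_ne s
      refine (mergeVars_fnMinor_of_nbhd (w := (s, y)) (t, 0) hkl ?_).trans (key _ _ ht.symm)
      rintro ⟨c, z⟩
      have := hy z
      simp only [hadj, Ne, Prod.mk.injEq]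
      grind
    · exact key k l h

theorem joinIrreducible_joinCopies {r n : ℕ} [Nonempty (Fin r)] [Nonempty (Fin n)] (hr : 2 ≤ r) :
    (joinCopies r (edgeless n)).JoinIrreducible := by
  have hadj : ∀ u v, (joinCopies r (edgeless n)).Adj u v ↔ u.1 ≠ v.1 := by
    intro u v
    simp [joinCopies]
  have : Nontrivial (Fin r) := Fin.nontrivial_iff_two_le.2 hr
  obtain ⟨p, q, hpq⟩ := exists_pair_ne (Fin r)
  obtain ⟨o⟩ := ‹Nonempty (Fin n)›
  have key : ∀ k l : Fin r × Fin n, k.1 ≠ l.1 →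
      FnMinor (mergeVars (joinCopies r (edgeless n)).edgeFn k l)
        (mergeVars (joinCopies r (edgeless n)).edgeFn (p, o) (q, o)) := by
    intro k l hkl
    obtain ⟨φ, h1, h2, h3⟩ := exists_perm_prod hpq hkl o o k.2 l.2
    exact mergeVars_fnMinor_of_iso ⟨φ, fun {u v} => by rw [hadj, hadj, Ne, h3]⟩ h1 h2
  refine joinIrreducible_of_forall_fnMinor (fun x => ?_) (i := (p, o)) (j := (q, o))
    (by simpa using hpq) fun k l hkl => ?_
  · obtain ⟨y, hy⟩ := exists_ne x.1
    exact ⟨(y, x.2), (hadj _ _).2 hy.symm⟩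
  · by_cases h : k.1 = l.1
    -- Two vertices of one part are nonadjacent twins, so their identification lies below that of
    -- `k` with a vertex of another part.
    · obtain ⟨t, ht⟩ := exists_ne k.1
      exact (mergeVars_fnMinor_of_twins (t, o) hkl (fun e => (hadj _ _).1 e h)
        fun x => by rw [hadj, hadj, h]).trans (key _ _ ht.symm)
    · exact key k l h

/-! ### Both directions after removal of isolated vertices. -/

theorem exists_adj_removeIsolated {V : Type*} (G : SimpleGraph V) (x : G.support) :
    ∃ y, G.removeIsolated.Adj x y := by
  obtain ⟨x, y, hxy⟩ := x
  exact ⟨⟨y, x, hxy.symm⟩, hxy⟩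

theorem joinIrreducible_iff_isListed {V : Type*} [Fintype V] [Nonempty V] (G : SimpleGraph V) :
    G.JoinIrreducible ↔ G.removeIsolated.IsListed := by
  classical
  constructor
  · intro h
    have : Nonempty G.support := by
      obtain ⟨i, hi, -⟩ := G.joinIrreducible_iff_mergeVars.1 h
      exact ⟨i, hi⟩
    have h' := (joinIrreducible_iff_of_iso (G := G) (Iso.refl (G := G.removeIsolated))).1 h
    exact isListed_of_nondegeneratePairs G.exists_adj_removeIsolated fun k l k' l' hk hk' =>
      h'.adj_and_ncard_le G.exists_adj_removeIsolated hk hk'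
  · rintro (⟨n, hn, ⟨e⟩⟩ | ⟨⟨e⟩⟩ | ⟨m, hm, ⟨e⟩⟩ | ⟨n, hn, ⟨e⟩⟩ | ⟨n, m, hn, hm, ⟨e⟩⟩ |
      ⟨r, n, hr, hn, ⟨e⟩⟩)
    · have : Nonempty (Fin n) := ⟨⟨0, by omega⟩⟩
      exact (joinIrreducible_iff_of_iso e).2 (joinIrreducible_disjointCopies hn)
    · exact (joinIrreducible_iff_of_iso e).2 joinIrreducible_cycleGraph_five
    · have : Nonempty (Fin m) := ⟨⟨0, by omega⟩⟩
      exact (joinIrreducible_iff_of_iso e).2 joinIrreducible_graphJoin_completeGraph_two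
    · have : Nonempty (Fin n) := ⟨⟨0, by omega⟩⟩
      exact (joinIrreducible_iff_of_iso e).2 (joinIrreducible_completeGraph hn)
    · have : Nonempty (Fin n) := ⟨⟨0, by omega⟩⟩
      have : Nonempty (Fin m) := ⟨⟨0, by omega⟩⟩
      exact (joinIrreducible_iff_of_iso e).2 joinIrreducible_graphJoin_edgeless
    · have : Nonempty (Fin n) := ⟨⟨0, by omega⟩⟩
      have : Nonempty (Fin r) := ⟨⟨0, by omega⟩⟩
      exact (joinIrreducible_iff_of_iso e).2 (joinIrreducible_joinCopies hr)

end SimpleGraph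

theorem mainTheorem2 {V : Type*} [Fintype V] [Nonempty V] (G : SimpleGraph V) :
    G.JoinIrreducible ↔
      (∃ n : ℕ, 2 ≤ n ∧
        Nonempty (G.removeIsolated ≃g
          SimpleGraph.disjointCopies n (SimpleGraph.completeGraph (Fin 3)))) ∨
      Nonempty (G.removeIsolated ≃g SimpleGraph.cycleGraph 5) ∨
      (∃ m : ℕ, 2 ≤ m ∧
        Nonempty (G.removeIsolated ≃g
          SimpleGraph.graphJoin (SimpleGraph.completeGraph (Fin 2)) (SimpleGraph.edgeless m))) ∨
      (∃ n : ℕ, 2 ≤ n ∧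
        Nonempty (G.removeIsolated ≃g SimpleGraph.completeGraph (Fin n))) ∨
      (∃ n m : ℕ, 1 ≤ n ∧ n < m ∧
        Nonempty (G.removeIsolated ≃g
          SimpleGraph.graphJoin (SimpleGraph.edgeless n) (SimpleGraph.edgeless m))) ∨
      (∃ r n : ℕ, 2 ≤ r ∧ 2 ≤ n ∧
        Nonempty (G.removeIsolated ≃g
          SimpleGraph.joinCopies r (SimpleGraph.edgeless n))) := by
  exact G.joinIrreducible_iff_isListed
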